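/- Fix an o-minimal structure on the real line (a structure on $\mathbb{R}$ in which the order $<$ is definable and every subset of $\mathbb{R}$ definable with parameters is a finite union of points and intervals); sets and maps are assumed definable in it with parameters. The empty set counts as connected. **Cones.** In $\mathbb{R}^m$ with coordinates $z_1,\dots,z_m$, a *coordinate cone* is a set $\{z : z_{j}\,\sigma_j\,c_j \text{ for all } j\in J\}$ with $J\subset\{1,\dots,m\}$, $\sigma_j\in\{<,=,>\}$, $c_j\in\mathbb{R}$; if all $\sigma_j$ are $=$, it is an *affine coordinate subspace*. (For $J=\emptyset$ it is $\mathbb{R}^m$.) **Semi-monotone sets, monotone functions.** An open bounded set $X\subset\mathbb{R}^n$ is *semi-monotone* if $X\cap C$ is connected for each coordinate cone $C$ in $\mathbb{R}^n$. A bounded upper semi-continuous function $h$ on a non-empty semi-monotone set $X$ is *submonotone* if $\{x\in X: h(x)<b\}$ is semi-monotone for every $b\in\mathbb{R}$, and $h$ is *supermonotone* if $-h$ is submonotone. We call $h$ strictly increasing in $x_j$ (respectively strictly decreasing in $x_j$, independent of $x_j$) if $h(x)<h(x')$ (respectively $h(x)>h(x')$, $h(x)=h(x')$) for all $x,x'\in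 X$ that differ only in the $j$-th coordinate and satisfy $x_j<x'_j$. A *monotone function* is one that is both sub- and supermonotone and, for each $j$, is strictly increasing in, or strictly decreasing in, or independent of $x_j$. **Monotone maps.** Let $n,k\ge 1$ and let $f=(f_1,\dots,f_k):X\to\mathbb{R}^k$ be a continuous bounded map on a non-empty set $X\subset\mathbb{R}^n$, with graph $F=\{(x,f(x)):x\in X\}\subset\mathbb{R}^{n+k}$, where $\mathbb{R}^{n+k}$ has coordinates $x_1,\dots,x_n,y_1,\dots,y_k$. A set $H$ of $n$ of these coordinates is a *basis set* of $f$ if the projection of $F$ to the coordinates in $H$ is injective. Assume that $X$ is semi-monotone. *Monotonicity of the map $f$* is defined by induction on $n$. If $n=1$, then $f$ is monotone if each $f_i$ is a monotone function. If $n\ge 2$, then $f$ is monotone if for all $i,j$ such that $f_i$ is not independent of $x_j$: 1. for each $b\in\mathbb{R}$ the set $F\cap\{y_i=b\}$, if non-empty, is (after dropping the coordinate $y_i$) the graph of a monotone map $f_{i,j,b}$ from a semi-monotone set in the space of the coordinates $x_1,\dots,x_{j-1},x_{j+1},\dots,x_n$ to the space of the coordinates $y_1,\dots,y_{i-1},x_j,y_{i+1},\dots,y_k$;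 2. the collection of basis sets of $f_{i,j,b}$ is the same for all $b$ for which $F\cap\{y_i=b\}\neq\emptyset$. **Quasi-affine maps.** A bounded continuous map $f:X\to\mathbb{R}^k$ on an open bounded non-empty set $X\subset\mathbb{R}^n$, with graph $F$, is *quasi-affine* if for every set $H$ of $n$ of the coordinates $x_1,\dots,x_n,y_1,\dots,y_k$ the projection of $F$ to the coordinates in $H$ is injective if and only if its image is $n$-dimensional. **Theorem.** Let $n,k\ge1$, and let $f=(f_1,\dots,f_k)$ be a (definable) bounded continuous quasi-affine map on an open bounded non-empty set $X\subset\mathbb{R}^n$, with graph $F\subset\mathbb{R}^{n+k}$. The following three statements are equivalent: (i) the map $f$ is monotone (in particular, $X$ is semi-monotone); (ii) for each affine coordinate subspace $S$ in $\mathbb{R}^{n+k}$ the intersection $F\cap S$ is connected; (iii) for each coordinate cone $C$ in $\mathbb{R}^{n+k}$ the intersection $F\cap C$ is connected. -/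

import Mathlib

universe u v

namespace MonotoneMaps

/-! ### O-minimal structures on the real line -/

/-- A first-order structure on `ℝ` is o-minimal if the order is definable and every subset of `ℝ`
that is definable with parameters is a finite union of intervals (order-connected subsets of `ℝ`;
these include points, rays, and the empty set). -/
structure IsOMinimal (L : FirstOrder.Language.{u, v}) [L.Structure ℝ] : Prop where
  definable_lt : (Set.univ : Set ℝ).Definable₂ L {p : ℝ × ℝ | p.1 < p.2}
  finite_union : ∀ s : Set ℝ, (Set.univ : Set ℝ).Definable₁ L s →
    ∃ T : Set (Set ℝ), T.Finite ∧ (∀ I ∈ T, I.OrdConnected) ∧ s = ⋃₀ T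

/-! ### Coordinate cones, affine coordinate subspaces, dimension

The space with coordinates labelled by `ι` is `ι → ℝ`. -/

section Coordinates

variable {ι : Type*}

/-- The set `{x | x j σ c}`, where `σ` is one of `<`, `=`, `>`
(encoded as `Ordering.lt`, `Ordering.eq`, `Ordering.gt`). -/
def coordSet (j : ι) (σ : Ordering) (c : ℝ) : Set (ι → ℝ) :=
  {x | cmp (x j) c = σ}

/-- Coordinate cones: at most one condition `x j σ c` for each coordinate. -/
def IsCoordCone (C : Set (ι → ℝ)) : Prop :=
  ∃ (J : Finset ι) (σ : ι → Ordering) (c : ι → ℝ), C = ⋂ j ∈ J, coordSet j (σ j) (c j)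

/-- Affine coordinate subspaces: at most one condition `x j = c` for each coordinate. -/
def IsAffineCoordSubspace (S : Set (ι → ℝ)) : Prop :=
  ∃ (J : Finset ι) (c : ι → ℝ), S = ⋂ j ∈ J, coordSet j Ordering.eq (c j)

/-- The dimension of a (definable) set is the largest `d` such that its projection to some
`d` of the coordinates has non-empty interior. The empty set has no dimension. -/
def HasDim (A : Set (ι → ℝ)) (d : ℕ) : Prop :=
  IsGreatest {e : ℕ | ∃ J : Finset ι, J.card = e ∧ (interior (J.restrict '' A)).Nonempty} d

/-- The points `x`, `y` differ at most in the coordinate `j`. -/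
def AgreeOff (j : ι) (x y : ι → ℝ) : Prop := ∀ l, l ≠ j → x l = y l

/-! ### Semi-monotone sets and monotone functions

Functions on a set `X` are given by total functions, of which only the values on `X` are used.
The definitions below do not mention definability: every set and map which they produce from a
definable set or map is again definable. -/

/-- Semi-monotone sets. The empty set counts as connected, hence `IsPreconnected`. -/
def IsSemiMonotone (X : Set (ι → ℝ)) : Prop :=
  IsOpen X ∧ Bornology.IsBounded X ∧ ∀ C : Set (ι → ℝ), IsCoordCone C → IsPreconnected (X ∩ C)

/-- Submonotone functions on a non-empty semi-monotone set. -/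
def IsSubmonotone (X : Set (ι → ℝ)) (f : (ι → ℝ) → ℝ) : Prop :=
  X.Nonempty ∧ IsSemiMonotone X ∧ Bornology.IsBounded (f '' X) ∧ UpperSemicontinuousOn f X ∧
    ∀ b : ℝ, IsSemiMonotone {x | x ∈ X ∧ f x < b}

/-- Supermonotone functions on a non-empty semi-monotone set. -/
def IsSupermonotone (X : Set (ι → ℝ)) (f : (ι → ℝ) → ℝ) : Prop :=
  IsSubmonotone X (fun x => -f x)

/-- `f` is strictly increasing in the coordinate `j` on `X`. -/
def StrictIncrIn (X : Set (ι → ℝ)) (f : (ι → ℝ) → ℝ) (j : ι) : Prop :=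
  ∀ x ∈ X, ∀ y ∈ X, AgreeOff j x y → x j < y j → f x < f y

/-- `f` is strictly decreasing in the coordinate `j` on `X`. -/
def StrictDecrIn (X : Set (ι → ℝ)) (f : (ι → ℝ) → ℝ) (j : ι) : Prop :=
  ∀ x ∈ X, ∀ y ∈ X, AgreeOff j x y → x j < y j → f y < f x

/-- `f` is independent of the coordinate `j` on `X`. -/
def IndepOf (X : Set (ι → ℝ)) (f : (ι → ℝ) → ℝ) (j : ι) : Prop :=
  ∀ x ∈ X, ∀ y ∈ X, AgreeOff j x y → f x = f y

/-- Monotone functions on a non-empty semi-monotone set. -/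
def IsMonotoneFunction (X : Set (ι → ℝ)) (f : (ι → ℝ) → ℝ) : Prop :=
  IsSubmonotone X f ∧ IsSupermonotone X f ∧
    ∀ j, StrictIncrIn X f j ∨ StrictDecrIn X f j ∨ IndepOf X f j

end Coordinates

/-! ### Monotone maps

The coordinates `x₁, …, xₙ, y₁, …, yₖ` are labelled by `Fin n ⊕ Fin k`. -/

section Maps

variable {n k : ℕ}

/-- The graph of `f` over `X`, a subset of the space with coordinates `x₁, …, xₙ, y₁, …, yₖ`. -/
def mapGraph (X : Set (Fin n → ℝ)) (f : (Fin n → ℝ) → Fin k → ℝ) : Set (Fin n ⊕ Fin k → ℝ) :=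
  (fun x => Sum.elim x (f x)) '' X

/-- The system of basis sets of `f`: the sets `H` of `n` labels such that the map formed by the
corresponding functions among `x₁, …, xₙ, f₁, …, fₖ` is injective on `X`. -/
def basisSets (X : Set (Fin n → ℝ)) (f : (Fin n → ℝ) → Fin k → ℝ) :
    Set (Finset (Fin n ⊕ Fin k)) :=
  {H | H.card = n ∧ Set.InjOn (fun x => H.restrict (Sum.elim x (f x) : Fin n ⊕ Fin k → ℝ)) X}

/-- `g`, defined on `X'`, is the map whose graph is the part of the graph of `f` in `{y i = b}`,
where the coordinate `x j` is removed from the domain and takes the place of `y i` in the range: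
the point `(x', y')` stands for the point with `x j = y' i`, with `y i = b`, and with all the
other coordinates as in `(x', y')`. -/
def IsLevelMap (X : Set (Fin (n + 1) → ℝ)) (f : (Fin (n + 1) → ℝ) → Fin k → ℝ)
    (i : Fin k) (j : Fin (n + 1)) (b : ℝ)
    (X' : Set (Fin n → ℝ)) (g : (Fin n → ℝ) → Fin k → ℝ) : Prop :=
  ∀ (x' : Fin n → ℝ) (y' : Fin k → ℝ),
    Sum.elim x' y' ∈ mapGraph X' g ↔
      Sum.elim (j.insertNth (y' i) x' : Fin (n + 1) → ℝ) (Function.update y' i b) ∈ mapGraph X f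

/-- The standing conditions on a map: it is continuous and bounded, and its domain is non-empty
and semi-monotone. -/
def IsAdmissible (X : Set (Fin n → ℝ)) (f : (Fin n → ℝ) → Fin k → ℝ) : Prop :=
  X.Nonempty ∧ IsSemiMonotone X ∧ ContinuousOn f X ∧ Bornology.IsBounded (f '' X)

/-- Monotone maps, by induction on the dimension `n ≥ 1` of the domain (the value for `n = 0` is
a dummy). -/
def IsMonotoneMap {k : ℕ} :
    (n : ℕ) → (X : Set (Fin n → ℝ)) → (f : (Fin n → ℝ) → Fin k → ℝ) → Prop
  | 0, _, _ => False
  | 1, X, f => IsAdmissible X f ∧ ∀ i, IsMonotoneFunction X (fun x => f x i)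
  | n + 2, X, f => IsAdmissible X f ∧
      ∀ (i : Fin k) (j : Fin (n + 2)), ¬ IndepOf X (fun x => f x i) j →
        (∀ b : ℝ, (∃ x ∈ X, f x i = b) →
          ∃ (X' : Set (Fin (n + 1) → ℝ)) (g : (Fin (n + 1) → ℝ) → Fin k → ℝ),
            IsLevelMap X f i j b X' g ∧ IsMonotoneMap (n + 1) X' g) ∧
        (∀ (b₁ b₂ : ℝ) (X₁ X₂ : Set (Fin (n + 1) → ℝ))
          (g₁ g₂ : (Fin (n + 1) → ℝ) → Fin k → ℝ), X₁.Nonempty → X₂.Nonempty →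
            IsLevelMap X f i j b₁ X₁ g₁ → IsLevelMap X f i j b₂ X₂ g₂ →
              basisSets X₁ g₁ = basisSets X₂ g₂)

/-- Quasi-affine maps: the projection of the graph to the span of any `n` of the coordinates
`x₁, …, xₙ, y₁, …, yₖ` is injective if and only if its image is `n`-dimensional. -/
def IsQuasiAffine (X : Set (Fin n → ℝ)) (f : (Fin n → ℝ) → Fin k → ℝ) : Prop :=
  ∀ H : Finset (Fin n ⊕ Fin k), H.card = n →
    (Set.InjOn (H.restrict : (Fin n ⊕ Fin k → ℝ) → H → ℝ) (mapGraph X f) ↔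
      HasDim ((H.restrict : (Fin n ⊕ Fin k → ℝ) → H → ℝ) '' mapGraph X f) n)

end Maps

end MonotoneMaps

namespace MonotoneMaps

/-! As far as projections to coordinates are concerned, a quasi-affine graph with connected sections
behaves like an affine subspace. `IsRegular` isolates what is needed for this: some `d` coordinates
form a chart, all sections by affine coordinate subspaces are connected, and a projection to `d`
coordinates whose image has interior points is injective.

The engine is the exchange property `IsRegular.isChart_update`. If a coordinate `y` varies along a
line of a chart, connectedness of the section over this line and the intermediate value theorem give
interior points of the projection with `y` in place of the chart coordinate moved. That projection
is then injective, and again a chart. Hence charts obey the exchange rule of the bases of a matroid.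
In particular every non-constant coordinate `z` lies in a chart, a non-empty slice `z = c` is
regular of dimension one less (`IsRegular.slice`), and its charts are the `e'` for which `z`
together with `e'` is a chart of the whole set, a condition free of `c`
(`IsRegular.injOn_slice_iff`).

From (ii) to (i): the level sets `y i = b` are slices, so they are regular graphs with basis sets
independent of `b`, and induction on `n` ends with continuous functions on an interval that are
injective or constant. From (ii) to (iii): half-spaces are added one at a time; in a chart
containing `z`, an open connected set whose section by the hyperplane `z = c` is connected has
connected halves (`isPreconnected_inter_of_boundary`). From (i) to (ii): if the subspace fixes some
`y i` that depends on some `x j`, pass to the level map and induct; otherwise semi-monotonicity of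
`X` suffices. -/

open Set Filter Topology Function

/-! ### Topological preliminaries in Euclidean space -/

/-- Suppose `A` and `B` separate `V ∩ D`. A small ball about a point of `V ∩ G` meets `D` in a
convex set, hence lies on one side there; as `V ∩ G` is connected, the side is the same along all of
it, say `A`. Then `A`, enlarged by everything of `V` outside `D`, and `B` separate `V`. -/
theorem isPreconnected_inter_of_boundary {E : Type*} [NormedAddCommGroup E] [NormedSpace ℝ E]
    {V D G : Set E} (hV : IsOpen V) (hD : IsOpen D) (hDc : Convex ℝ D) (hGD : G ⊆ closure D)
    (hDG : closure D ⊆ D ∪ G) (h : IsPreconnected V) (hG : IsPreconnected (V ∩ G)) :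
    IsPreconnected (V ∩ D) := by
  rw [isPreconnected_iff_subset_of_disjoint]
  intro A B hA hB hcov hdis
  -- Points near which `V ∩ D` lies in `A`; away from the closure of `D` the condition is vacuous.
  let P : Set E → Set E := fun A => {p | ∀ᶠ q in 𝓝 p, q ∈ V ∩ D → q ∈ A}
  have hP : ∀ A, IsOpen (P A) := fun A => isOpen_setOfPred_eventually_nhds
  have key : ∀ A B : Set E, IsOpen A → IsOpen B → V ∩ D ⊆ A ∪ B → V ∩ D ∩ (A ∩ B) = ∅ →
      V ∩ G ⊆ P A → V ∩ D ⊆ A ∨ V ∩ D ⊆ B := by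
    intro A B hA hB hcov hdis hGA
    have h1 : V ⊆ P A ∪ V ∩ D ∩ B := by
      intro p hp
      by_cases hpD : p ∈ D
      · rcases hcov ⟨hp, hpD⟩ with h2 | h2
        · left
          filter_upwards [hA.mem_nhds h2] with q hq _ using hq
        · exact Or.inr ⟨⟨hp, hpD⟩, h2⟩
      · left
        by_cases hc : p ∈ closure D
        · exact hGA ⟨hp, (hDG hc).resolve_left hpD⟩
        · filter_upwards [isClosed_closure.isOpen_compl.mem_nhds hc] with q hq hq2
          exact absurd (subset_closure hq2.2) hq
    have h2 : V ∩ (P A ∩ (V ∩ D ∩ B)) = ∅ := by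
      refine eq_empty_of_forall_notMem ?_
      rintro p ⟨_, hpA, hpB⟩
      exact eq_empty_iff_forall_notMem.1 hdis p ⟨hpB.1, hpA.self_of_nhds hpB.1, hpB.2⟩
    rcases isPreconnected_iff_subset_of_disjoint.1 h (P A) (V ∩ D ∩ B) (hP A)
      ((hV.inter hD).inter hB) h1 h2 with h1 | h1
    · left
      intro p hp
      exact (h1 hp.1).self_of_nhds hp
    · right
      intro p hp
      exact (h1 hp.1).2
  have hcovG : V ∩ G ⊆ P A ∪ P B := by
    rintro p ⟨hpV, hpG⟩
    obtain ⟨r, hr, hrV⟩ := Metric.isOpen_iff.1 hV p hpV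
    have hpc : IsPreconnected (Metric.ball p r ∩ D) :=
      ((convex_ball p r).inter hDc).isPreconnected
    have hsub : Metric.ball p r ∩ D ⊆ V ∩ D := inter_subset_inter_left _ hrV
    rcases isPreconnected_iff_subset_of_disjoint.1 hpc A B hA hB (hsub.trans hcov)
      (subset_eq_empty (inter_subset_inter_left _ hsub) hdis) with h1 | h1
    · left
      filter_upwards [Metric.ball_mem_nhds p hr] with q hq hq2 using h1 ⟨hq, hq2.2⟩
    · right
      filter_upwards [Metric.ball_mem_nhds p hr] with q hq hq2 using h1 ⟨hq, hq2.2⟩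
  have hdisG : V ∩ G ∩ (P A ∩ P B) = ∅ := by
    refine eq_empty_of_forall_notMem ?_
    rintro p ⟨⟨hpV, hpG⟩, hpA, hpB⟩
    have hVp : ∀ᶠ q in 𝓝 p, q ∈ V := hV.mem_nhds hpV
    obtain ⟨q, hqD, hqV, hqA, hqB⟩ := ((mem_closure_iff_frequently.1 (hGD hpG)).and_eventually
      (hVp.and (hpA.and hpB))).exists
    exact eq_empty_iff_forall_notMem.1 hdis q
      ⟨⟨hqV, hqD⟩, hqA ⟨hqV, hqD⟩, hqB ⟨hqV, hqD⟩⟩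
  rcases isPreconnected_iff_subset_of_disjoint.1 hG _ _ (hP A) (hP B) hcovG hdisG with h1 | h1
  · exact key A B hA hB hcov hdis h1
  · exact (key B A hB hA (by rwa [union_comm]) (by rwa [inter_comm B A]) h1).symm

/-- The half spaces `w m < c` and `w m > c` satisfy the hypotheses of
`isPreconnected_inter_of_boundary` with the hyperplane `w m = c` as boundary. -/
theorem isPreconnected_inter_coordSet {d : ℕ} {V : Set (Fin d → ℝ)} (hV : IsOpen V) (m : Fin d)
    (c : ℝ) {σ : Ordering} (hσ : σ ≠ Ordering.eq) (h : IsPreconnected V)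
    (hG : IsPreconnected (V ∩ {w | w m = c})) : IsPreconnected (V ∩ coordSet m σ c) := by
  -- `ε` will be `-1` or `1`, the direction that leads from the hyperplane into `D`.
  have hcl : ∀ D : Set (Fin d → ℝ), (∀ w : Fin d → ℝ, w m = c →
      ∃ ε : ℝ, ∀ t > (0 : ℝ), update w m (c + ε * t) ∈ D) → {w | w m = c} ⊆ closure D := by
    intro D hD w hw
    obtain ⟨ε, hε⟩ := hD w hw
    have ht : Tendsto (fun t : ℝ => update w m (c + ε * t)) (𝓝[>] 0) (𝓝 w) := by
      have h1 : Continuous (fun t : ℝ => update w m (c + ε * t)) :=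
        continuous_const.update m (by fun_prop)
      have h2 := h1.tendsto 0
      simp only [mul_zero, add_zero] at h2
      rw [← hw.out, update_eq_self] at h2
      rw [← hw.out]
      exact h2.mono_left nhdsWithin_le_nhds
    refine mem_closure_of_tendsto ht ?_
    filter_upwards [self_mem_nhdsWithin] with t ht using hε t ht
  have hm : Continuous fun w : Fin d → ℝ => w m := continuous_apply m
  have hlin : IsLinearMap ℝ fun w : Fin d → ℝ => w m := ⟨fun _ _ => rfl, fun _ _ => rfl⟩
  cases σ with
  | eq => exact absurd rfl hσ
  | lt =>
    have he : coordSet m Ordering.lt c = {w : Fin d → ℝ | w m < c} := by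
      ext w; simp [coordSet]
    rw [he]
    refine isPreconnected_inter_of_boundary hV (isOpen_lt hm continuous_const)
      (convex_halfSpace_lt hlin c) (hcl _ fun w _ => ⟨-1, fun t ht => by simpa using ht⟩)
      ?_ h hG
    refine (closure_minimal (t := {w : Fin d → ℝ | w m ≤ c}) (fun w hw => le_of_lt hw.out)
      (isClosed_le hm continuous_const)).trans fun w hw => ?_
    exact lt_or_eq_of_le hw.out
  | gt =>
    have he : coordSet m Ordering.gt c = {w : Fin d → ℝ | c < w m} := by
      ext w; simp [coordSet]
    rw [he]
    refine isPreconnected_inter_of_boundary hV (isOpen_lt continuous_const hm)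
      (convex_halfSpace_gt hlin c) (hcl _ fun w _ => ⟨1, fun t ht => by simpa using ht⟩)
      ?_ h hG
    refine (closure_minimal (t := {w : Fin d → ℝ | c ≤ w m}) (fun w hw => le_of_lt hw.out)
      (isClosed_le continuous_const hm)).trans fun w hw => ?_
    rcases lt_or_eq_of_le hw.out with h1 | h1
    · exact Or.inl h1
    · exact Or.inr h1.symm

/-- This takes the place of an inverse function theorem. The inequalities at `a` and `b` persist on
nearby lines in direction `m`, and on each of these the intermediate value theorem attains the
required value. -/
theorem update_image_mem_nhds {d : ℕ} {V : Set (Fin d → ℝ)} (hV : IsOpen V)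
    {φ : (Fin d → ℝ) → ℝ} (hφ : ContinuousOn φ V) (m : Fin d)
    (hconn : ∀ w : Fin d → ℝ, IsPreconnected {t : ℝ | update w m t ∈ V})
    {w : Fin d → ℝ} {a b c : ℝ} (ha : update w m a ∈ V) (hb : update w m b ∈ V)
    (hac : φ (update w m a) < c) (hcb : c < φ (update w m b)) :
    (fun w => update w m (φ w)) '' V ∈ 𝓝 (update w m c) := by
  have htend : ∀ a : ℝ, Tendsto (fun w' : Fin d → ℝ => update w' m a) (𝓝 (update w m c))
      (𝓝 (update w m a)) := by
    intro a
    have h1 : Continuous fun w' : Fin d → ℝ => update w' m a :=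
      continuous_id.update m continuous_const
    simpa using h1.tendsto (update w m c)
  have hm : Tendsto (fun w' : Fin d → ℝ => w' m) (𝓝 (update w m c)) (𝓝 c) := by
    simpa using (continuous_apply m).tendsto (update w m c)
  have hφa := (hφ.continuousAt (hV.mem_nhds ha)).tendsto.comp (htend a)
  have hφb := (hφ.continuousAt (hV.mem_nhds hb)).tendsto.comp (htend b)
  filter_upwards [htend a (hV.mem_nhds ha), htend b (hV.mem_nhds hb),
    hφa.eventually_lt hm hac, hm.eventually_lt hφb hcb] with w' h1 h2 h3 h4
  have hupd : Continuous fun t : ℝ => update w' m t := continuous_const.update m continuous_id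
  have hcont : ContinuousOn (fun t : ℝ => φ (update w' m t)) {t : ℝ | update w' m t ∈ V} :=
    hφ.comp hupd.continuousOn fun t ht => ht
  obtain ⟨t, ht, hteq⟩ := (hconn w').intermediate_value h1 h2 hcont ⟨h3.le, h4.le⟩
  exact ⟨_, ht, by simpa using congrArg (fun x => update w' m x) hteq⟩

theorem isPreconnected_setOf_update_mem_ball {d : ℕ} (w₀ : Fin d → ℝ) (r : ℝ) (m : Fin d)
    (w : Fin d → ℝ) : IsPreconnected {t : ℝ | update w m t ∈ Metric.ball w₀ r} := by
  have h1 : {t : ℝ | update w m t ∈ Metric.ball w₀ r} =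
      (AffineMap.lineMap (update w m 0) (update w m 1) : ℝ →ᵃ[ℝ] (Fin d → ℝ)) ⁻¹'
        Metric.ball w₀ r := by
    ext t
    have : (AffineMap.lineMap (update w m 0) (update w m 1) : ℝ →ᵃ[ℝ] (Fin d → ℝ)) t =
        update w m t := by
      ext l
      by_cases hl : l = m
      · subst hl; simp [AffineMap.lineMap_apply]
      · simp [AffineMap.lineMap_apply, hl]
    rw [mem_preimage, this, mem_ofPred_eq]
  rw [h1]
  exact ((convex_ball w₀ r).affine_preimage _).isPreconnected

/-- A function on an open set `U` that does not depend on the coordinates in `A` is constant on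
connected sections of `U` along these coordinates. -/
theorem eq_of_indep_of_isPreconnected {d : ℕ} {U : Set (Fin d → ℝ)} (hU : IsOpen U)
    (φ : (Fin d → ℝ) → ℝ) (A : Finset (Fin d))
    (hind : ∀ l ∈ A, ∀ u ∈ U, ∀ v ∈ U, AgreeOff l u v → φ u = φ v) {L : Set (Fin d → ℝ)}
    (hLU : L ⊆ U) (hagree : ∀ u ∈ L, ∀ v ∈ L, ∀ l ∉ A, u l = v l) (hL : IsPreconnected L)
    {u v : Fin d → ℝ} (hu : u ∈ L) (hv : v ∈ L) : φ u = φ v := by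
  -- Balls of the sup norm are boxes, so coordinates can be changed one at a time without leaving
  -- them.
  have hbox : ∀ (w₀ : Fin d → ℝ) (r : ℝ), Metric.ball w₀ r ⊆ U → ∀ A' ⊆ A,
      ∀ u ∈ Metric.ball w₀ r, ∀ v ∈ Metric.ball w₀ r, (∀ l ∉ A', u l = v l) → φ u = φ v := by
    intro w₀ r hball A'
    induction A' using Finset.induction_on with
    | empty =>
      intro _ u _ v _ h
      rw [funext fun l => h l (Finset.notMem_empty l)]
    | insert a A' ha ih =>
      intro hsub u hu v hv h
      have hv' : update v a (u a) ∈ Metric.ball w₀ r := by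
        have hr : 0 < r := dist_nonneg.trans_lt (Metric.mem_ball.1 hu)
        rw [Metric.mem_ball, dist_pi_lt_iff hr] at hu hv ⊢
        intro l
        by_cases hl : l = a
        · subst hl; simpa using hu l
        · simpa [hl] using hv l
      rw [ih (fun x hx => hsub (Finset.mem_insert_of_mem hx)) u hu _ hv' ?_]
      · exact hind a (hsub (Finset.mem_insert_self a A')) _ (hball hv') _ (hball hv)
          fun l hl => by simp [hl]
      · intro l hl
        by_cases hla : l = a
        · subst hla; simp
        · simpa [hla] using h l (by simp [hla, hl])
  have hloc : IsLocallyConstant fun w : L => φ w := by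
    rw [IsLocallyConstant.iff_eventually_eq]
    intro w
    obtain ⟨r, hr, hball⟩ := Metric.isOpen_iff.1 hU w (hLU w.2)
    filter_upwards [continuous_subtype_val.continuousAt.preimage_mem_nhds
      (Metric.ball_mem_nhds (w : Fin d → ℝ) hr)] with w' hw'
    exact hbox w r hball A subset_rfl _ hw' _ (Metric.mem_ball_self hr)
      fun l hl => hagree _ w'.2 _ w.2 l hl
  have := isPreconnected_iff_preconnectedSpace.1 hL
  exact hloc.apply_eq_of_isPreconnected isPreconnected_univ (x := ⟨u, hu⟩) (y := ⟨v, hv⟩)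
    (mem_univ _) (mem_univ _)

/-! ### Charts and the exchange property -/

section Charts

variable {ι : Type*} {d : ℕ} {F : Set (ι → ℝ)}

/-- The coordinates `e` form a chart of `F`: the projection to them is an injective map, open on
`F`. -/
def IsChart (F : Set (ι → ℝ)) (e : Fin d → ι) : Prop :=
  InjOn (fun p : ι → ℝ => p ∘ e) F ∧
    ∀ p ∈ F, ∀ N ∈ 𝓝 p, (fun p : ι → ℝ => p ∘ e) '' (F ∩ N) ∈ 𝓝 (p ∘ e)

/-- The points that agree with `q` in the coordinates from `J`. -/
def agreeSet (J : Finset ι) (q : ι → ℝ) : Set (ι → ℝ) := {p | ∀ j ∈ J, p j = q j}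

/-- A set that is the graph over an open subset of some `d` coordinates, with connected sections
by affine coordinate subspaces, and such that every projection to `d` coordinates whose image has
interior points is injective. -/
structure IsRegular (d : ℕ) (F : Set (ι → ℝ)) : Prop where
  nonempty : F.Nonempty
  exists_chart : ∃ e : Fin d → ι, IsChart F e
  sections : ∀ J q, IsPreconnected (F ∩ agreeSet J q)
  injOn : ∀ e : Fin d → ι, (interior ((fun p : ι → ℝ => p ∘ e) '' F)).Nonempty →
    InjOn (fun p : ι → ℝ => p ∘ e) F

theorem continuous_comp_coord {κ : Type*} (e : κ → ι) :
    Continuous fun p : ι → ℝ => p ∘ e :=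
  continuous_pi fun l => continuous_apply (e l)

theorem IsChart.isOpen_image {e : Fin d → ι} (he : IsChart F e) :
    IsOpen ((fun p : ι → ℝ => p ∘ e) '' F) := by
  rw [isOpen_iff_mem_nhds]
  rintro _ ⟨p, hp, rfl⟩
  simpa using he.2 p hp univ univ_mem

/-- Openness of the projection on `F` is continuity of its inverse. -/
theorem IsChart.exists_section {e : Fin d → ι} (he : IsChart F e) :
    ∃ s : (Fin d → ℝ) → ι → ℝ, ContinuousOn s ((fun p : ι → ℝ => p ∘ e) '' F) ∧
      (∀ p ∈ F, s (p ∘ e) = p) ∧ ∀ u ∈ (fun p : ι → ℝ => p ∘ e) '' F, s u ∈ F ∧ s u ∘ e = u := by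
  have hs : ∀ p ∈ F, invFunOn (fun p : ι → ℝ => p ∘ e) F (p ∘ e) = p := fun p hp =>
    he.1.leftInvOn_invFunOn hp
  refine ⟨invFunOn (fun p : ι → ℝ => p ∘ e) F, ?_, hs, ?_⟩
  · rintro _ ⟨p, hp, rfl⟩
    refine ContinuousAt.continuousWithinAt ?_
    intro N hN
    change invFunOn (fun p : ι → ℝ => p ∘ e) F ⁻¹' N ∈ 𝓝 (p ∘ e)
    simp only [hs p hp] at hN
    filter_upwards [he.2 p hp N hN]
    rintro _ ⟨q, ⟨hq, hqN⟩, rfl⟩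
    simpa only [mem_preimage, hs q hq] using hqN
  · rintro _ ⟨p, hp, rfl⟩
    simp only [hs p hp]
    exact ⟨hp, trivial⟩

theorem IsChart.of_section {e : Fin d → ι} {s : (Fin d → ℝ) → ι → ℝ}
    (ho : IsOpen ((fun p : ι → ℝ => p ∘ e) '' F))
    (hs : ContinuousOn s ((fun p : ι → ℝ => p ∘ e) '' F)) (h : ∀ p ∈ F, s (p ∘ e) = p) :
    IsChart F e := by
  refine ⟨fun p hp q hq hpq => ?_, fun p hp N hN => ?_⟩
  · rw [← h p hp, ← h q hq]
    exact congrArg s hpq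
  · have hmem := ho.mem_nhds (mem_image_of_mem (fun p : ι → ℝ => p ∘ e) hp)
    have hc : ContinuousAt s (p ∘ e) := hs.continuousAt hmem
    filter_upwards [hmem, hc.preimage_mem_nhds (by rwa [h p hp])]
    rintro _ ⟨q, hq, rfl⟩ hqN
    exact ⟨q, ⟨hq, by simpa [h q hq] using hqN⟩, rfl⟩

theorem IsChart.comp_perm {e : Fin d → ι} (he : IsChart F e) (σ : Equiv.Perm (Fin d)) :
    IsChart F (e ∘ σ) := by
  have hσ : ∀ p : ι → ℝ, (p ∘ (e ∘ σ)) ∘ σ.symm = p ∘ e := fun p => by ext; simp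
  refine ⟨fun p hp q hq hpq => he.1 hp hq ?_, fun p hp N hN => ?_⟩
  · simp only [← hσ]
    exact congrArg (fun w : Fin d → ℝ => w ∘ σ.symm) hpq
  · have h1 : Continuous fun w : Fin d → ℝ => w ∘ σ.symm := continuous_comp_coord _
    have h2 := h1.continuousAt (x := p ∘ (e ∘ σ))
    filter_upwards [h2.preimage_mem_nhds (by rw [hσ]; exact he.2 p hp N hN)]
    rintro w ⟨q, hq, hqw⟩
    refine ⟨q, hq, ?_⟩
    have := congrArg (fun w : Fin d → ℝ => w ∘ σ) hqw
    simpa [comp_assoc] using this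

/-- If some projection of `F` is a chart, then each of its coordinates can be moved alone. -/
theorem exists_ne_of_interior_nonempty {e : Fin d → ι}
    (h : (interior ((fun p : ι → ℝ => p ∘ e) '' F)).Nonempty) (l : Fin d) :
    ∃ p ∈ F, ∃ q ∈ F, (∀ l' ≠ l, p (e l') = q (e l')) ∧ p (e l) ≠ q (e l) := by
  obtain ⟨w, hw⟩ := h
  have hc : Continuous fun t : ℝ => update w l t := continuous_const.update l continuous_id
  have h1 := hc.continuousAt (x := w l)
  have h2 : ∀ᶠ t in 𝓝[>] (w l), update w l t ∈ (fun p : ι → ℝ => p ∘ e) '' F :=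
    nhdsWithin_le_nhds (h1.preimage_mem_nhds (by
      rw [update_eq_self]; exact mem_interior_iff_mem_nhds.1 hw))
  obtain ⟨t, ⟨q, hq, hqt⟩, ht⟩ := (h2.and self_mem_nhdsWithin).exists
  obtain ⟨p, hp, hpw⟩ := interior_subset hw
  have hp' : ∀ l', p (e l') = w l' := fun l' => congrFun hpw l'
  have hq' : ∀ l', q (e l') = update w l t l' := fun l' => congrFun hqt l'
  refine ⟨p, hp, q, hq, fun l' hl' => by rw [hp', hq', update_of_ne hl'], ?_⟩
  rw [hp', hq', update_self]
  exact (mem_Ioi.1 ht).ne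

theorem IsChart.interior_nonempty {e : Fin d → ι} (he : IsChart F e) (hF : F.Nonempty) :
    (interior ((fun p : ι → ℝ => p ∘ e) '' F)).Nonempty := by
  rw [he.isOpen_image.interior_eq]
  exact hF.image _

/-- The part of the line inside the image is traced by the section of `F` on which the coordinates
`e l`, `l ≠ m`, are fixed. -/
theorem isPreconnected_setOf_update_mem_image (hs : ∀ J q, IsPreconnected (F ∩ agreeSet J q))
    (e : Fin d → ι) (m : Fin d) (w : Fin d → ℝ) :
    IsPreconnected {t : ℝ | update w m t ∈ (fun p : ι → ℝ => p ∘ e) '' F} := by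
  classical
  rcases eq_empty_or_nonempty {t : ℝ | update w m t ∈ (fun p : ι → ℝ => p ∘ e) '' F} with h | h
  · rw [h]; exact isPreconnected_empty
  obtain ⟨t₀, p₀, -, hp₀⟩ := h
  have hp₀' : ∀ l ≠ m, p₀ (e l) = w l := fun l hl => by
    have := congrFun hp₀ l
    simpa [hl] using this
  have heq : {t : ℝ | update w m t ∈ (fun p : ι → ℝ => p ∘ e) '' F} =
      (fun p : ι → ℝ => p (e m)) '' (F ∩ agreeSet ((Finset.univ.erase m).image e) p₀) := by
    ext t
    constructor
    · rintro ⟨p, hp, hpt⟩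
      have hpt' : ∀ l, p (e l) = update w m t l := fun l => congrFun hpt l
      refine ⟨p, ⟨hp, ?_⟩, by simp [hpt']⟩
      intro j hj
      obtain ⟨l, hl, rfl⟩ := Finset.mem_image.1 hj
      have hlm := (Finset.mem_erase.1 hl).1
      rw [hpt', hp₀' l hlm, update_of_ne hlm]
    · rintro ⟨p, ⟨hp, hpa⟩, rfl⟩
      refine ⟨p, hp, ?_⟩
      ext l
      by_cases hl : l = m
      · subst hl; simp
      · have := hpa (e l) (Finset.mem_image_of_mem e (by simp [hl]))
        simp [hl, this, hp₀' l hl]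
  rw [heq]
  exact (hs _ _).image _ (continuous_apply (e m)).continuousOn

/-- Exchange: a coordinate `y` that depends on the chart coordinate `e m` can replace it. -/
theorem IsRegular.isChart_update (hF : IsRegular d F) {e : Fin d → ι} (he : IsChart F e)
    (m : Fin d) (y : ι)
    (hdep : ∃ p ∈ F, ∃ q ∈ F, (∀ l ≠ m, p (e l) = q (e l)) ∧ p y ≠ q y) :
    IsChart F (update e m y) := by
  obtain ⟨s, hsc, hsp, hsu⟩ := he.exists_section
  set U := (fun p : ι → ℝ => p ∘ e) '' F with hU
  have hUo : IsOpen U := he.isOpen_image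
  set φ : (Fin d → ℝ) → ℝ := fun u => s u y with hφdef
  have hφ : ContinuousOn φ U := (continuous_apply y).comp_continuousOn hsc
  have hcomp : ∀ p : ι → ℝ, p ∘ update e m y = update (p ∘ e) m (p y) := fun p => comp_update ..
  have himage : ∀ u ∈ U, update u m (φ u) = s u ∘ update e m y := fun u hu => by
    rw [hcomp, (hsu u hu).2]
  -- A value strictly between `p y` and `q y` gives an interior point of the new projection, which
  -- the regularity axiom then turns into injectivity.
  have hint : ∀ p ∈ F, ∀ q ∈ F, (∀ l ≠ m, p (e l) = q (e l)) → p y < q y →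
      (interior ((fun p : ι → ℝ => p ∘ update e m y) '' F)).Nonempty := by
    intro p hp q hq hpq hlt
    have hq1 : q ∘ e = update (p ∘ e) m (q (e m)) := by
      ext l
      by_cases hl : l = m
      · subst hl; simp
      · simp [hl, hpq l hl]
    have hp1 : update (p ∘ e) m (p (e m)) = p ∘ e := update_eq_self m (p ∘ e)
    obtain ⟨c, hc1, hc2⟩ := exists_between hlt
    have := update_image_mem_nhds hUo hφ m (isPreconnected_setOf_update_mem_image hF.sections e m)
      (w := p ∘ e) (a := p (e m)) (b := q (e m)) (c := c) (by rw [hp1]; exact ⟨p, hp, rfl⟩)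
      (by rw [← hq1]; exact ⟨q, hq, rfl⟩) (by simpa only [hp1, hφdef, hsp p hp] using hc1)
      (by simpa only [← hq1, hφdef, hsp q hq] using hc2)
    refine ⟨_, mem_interior_iff_mem_nhds.2 (mem_of_superset this ?_)⟩
    rintro _ ⟨u, hu, rfl⟩
    exact ⟨s u, (hsu u hu).1, (himage u hu).symm⟩
  have hinj : InjOn (fun p : ι → ℝ => p ∘ update e m y) F := by
    obtain ⟨p, hp, q, hq, hpq, hne⟩ := hdep
    rcases lt_or_gt_of_ne hne with h | h
    · exact hF.injOn _ (hint p hp q hq hpq h)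
    · exact hF.injOn _ (hint q hq p hp (fun l hl => (hpq l hl).symm) h)
  refine ⟨hinj, fun p hp N hN => ?_⟩
  have hpU : p ∘ e ∈ U := ⟨p, hp, rfl⟩
  have hsN : s ⁻¹' N ∈ 𝓝 (p ∘ e) :=
    (hsc.continuousAt (hUo.mem_nhds hpU)).preimage_mem_nhds (by rwa [hsp p hp])
  obtain ⟨r, hr, hball⟩ := Metric.mem_nhds_iff.1 (inter_mem (hUo.mem_nhds hpU) hsN)
  set V := Metric.ball (p ∘ e) r with hV
  have hVU : V ⊆ U := fun v hv => (hball hv).1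
  have hsub : (fun w => update w m (φ w)) '' V ⊆
      (fun p : ι → ℝ => p ∘ update e m y) '' (F ∩ N) := by
    rintro _ ⟨v, hv, rfl⟩
    exact ⟨s v, ⟨(hsu v (hVU hv)).1, (hball hv).2⟩, (himage v (hVU hv)).symm⟩
  set t₀ := p (e m) with ht₀
  have hup : update (p ∘ e) m t₀ = p ∘ e := update_eq_self m (p ∘ e)
  set a := t₀ - r / 2
  set b := t₀ + r / 2
  have hab : ∀ t ∈ Icc a b, update (p ∘ e) m t ∈ V := by
    intro t ht
    have ht1 : p (e m) - r / 2 ≤ t := ht.1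
    have ht2 : t ≤ p (e m) + r / 2 := ht.2
    rw [hV, Metric.mem_ball, dist_pi_lt_iff hr]
    intro l
    by_cases hl : l = m
    · subst hl
      simp only [update_self, comp_apply, Real.dist_eq, abs_lt]
      constructor <;> linarith
    · simpa [hl] using hr
  have hupd : Continuous fun t : ℝ => update (p ∘ e) m t := continuous_const.update m continuous_id
  have hgc : ContinuousOn (fun t => φ (update (p ∘ e) m t)) (Icc a b) :=
    hφ.comp hupd.continuousOn fun t ht => hVU (hab t ht)
  -- Global injectivity makes `φ` injective, hence strictly monotone, along the segment through `p`
  -- inside any small ball. The values at its two ends enclose the value at `p`, so the openness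
  -- argument applies locally.
  have hgi : InjOn (fun t => φ (update (p ∘ e) m t)) (Icc a b) := by
    intro t ht t' ht' htt
    have h1 := hVU (hab t ht)
    have h2 := hVU (hab t' ht')
    have h3 : s (update (p ∘ e) m t) = s (update (p ∘ e) m t') := by
      refine hinj (hsu _ h1).1 (hsu _ h2).1 ?_
      simp only
      rw [← himage _ h1, ← himage _ h2]
      simp only [update_idem] at htt ⊢
      rw [htt]
    have h4 := congrFun ((hsu _ h1).2.symm.trans ((congrArg (· ∘ e) h3).trans (hsu _ h2).2)) m
    simpa using h4
  have hta : a < t₀ := by simp only [a]; linarith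
  have htb : t₀ < b := by simp only [b]; linarith
  have hma : a ∈ Icc a b := ⟨le_rfl, (hta.trans htb).le⟩
  have hmb : b ∈ Icc a b := ⟨(hta.trans htb).le, le_rfl⟩
  have hmt : t₀ ∈ Icc a b := ⟨hta.le, htb.le⟩
  have hnhds : ∀ a' ∈ Icc a b, ∀ b' ∈ Icc a b, φ (update (p ∘ e) m a') < φ (update (p ∘ e) m t₀) →
      φ (update (p ∘ e) m t₀) < φ (update (p ∘ e) m b') →
      (fun p : ι → ℝ => p ∘ update e m y) '' (F ∩ N) ∈ 𝓝 (p ∘ update e m y) := by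
    intro a' ha' b' hb' h1 h2
    have := update_image_mem_nhds Metric.isOpen_ball (hφ.mono hVU) m
      (isPreconnected_setOf_update_mem_ball (p ∘ e) r m) (hab a' ha') (hab b' hb') h1 h2
    rw [hup] at this
    simp only [hφdef, hsp p hp] at this
    rw [hcomp]
    exact mem_of_superset this hsub
  rcases hgc.strictMonoOn_of_injOn_Icc' (hta.trans htb).le hgi with h | h
  · exact hnhds a hma b hmb (h hma hmt hta) (h hmt hmb htb)
  · exact hnhds b hmb a hma (h hmt hmb htb) (h hma hmt hta)

/-- A coordinate that does not depend on the chart coordinates from `A` is a function of the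
remaining ones. -/
theorem IsRegular.eq_of_indep (hF : IsRegular d F) {e : Fin d → ι} (he : IsChart F e)
    (A : Finset (Fin d)) (y : ι)
    (hind : ∀ m ∈ A, ∀ p ∈ F, ∀ q ∈ F, (∀ l ≠ m, p (e l) = q (e l)) → p y = q y)
    {p q : ι → ℝ} (hp : p ∈ F) (hq : q ∈ F) (hpq : ∀ l ∉ A, p (e l) = q (e l)) :
    p y = q y := by
  classical
  obtain ⟨s, hsc, hsp, hsu⟩ := he.exists_section
  set M := F ∩ agreeSet (Aᶜ.image e) p with hM
  have key := eq_of_indep_of_isPreconnected he.isOpen_image (fun u => s u y) A ?_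
    (L := (fun p : ι → ℝ => p ∘ e) '' M) (image_mono inter_subset_left) ?_
    ((hF.sections _ _).image _ (continuous_comp_coord e).continuousOn)
    (u := p ∘ e) (v := q ∘ e) ⟨p, ⟨hp, fun _ _ => rfl⟩, rfl⟩ ⟨q, ⟨hq, ?_⟩, rfl⟩
  · simpa only [hsp p hp, hsp q hq] using key
  · intro l hl u hu v hv huv
    refine hind l hl _ (hsu u hu).1 _ (hsu v hv).1 fun l' hl' => ?_
    have h1 := congrFun (hsu u hu).2 l'
    have h2 := congrFun (hsu v hv).2 l'
    simp only [comp_apply] at h1 h2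
    rw [h1, h2, huv l' hl']
  · rintro _ ⟨u, hu, rfl⟩ _ ⟨v, hv, rfl⟩ l hl
    have hmem : e l ∈ Aᶜ.image e := Finset.mem_image_of_mem e (by simpa using hl)
    exact (hu.2 _ hmem).trans (hv.2 _ hmem).symm
  · intro j hj
    obtain ⟨l, hl, rfl⟩ := Finset.mem_image.1 hj
    exact (hpq l (by simpa using hl)).symm

/-- A non-constant coordinate belongs to a chart. -/
theorem IsRegular.exists_chart_mem (hF : IsRegular d F) {z : ι}
    (hz : ∃ p ∈ F, ∃ q ∈ F, p z ≠ q z) :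
    ∃ (e : Fin d → ι) (m : Fin d), IsChart F e ∧ e m = z := by
  obtain ⟨e, he⟩ := hF.exists_chart
  obtain ⟨p, hp, q, hq, hpq⟩ := hz
  -- If `z` were in no chart, exchange would make it independent of each coordinate of `e`, hence
  -- constant.
  by_contra! hcon
  refine hpq (hF.eq_of_indep he Finset.univ z ?_ hp hq (by simp))
  intro m _ p hp q hq h
  by_contra hne
  exact hcon _ m (hF.isChart_update he m z ⟨p, hp, q, hq, h, hne⟩) (by simp)

/-- Coordinates `e'`, none of which outside a given chart is a function of the others, form
a chart. -/
theorem IsRegular.isChart_of_exists_ne (hF : IsRegular d F) {e : Fin d → ι} (he : IsChart F e)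
    (e' : Fin d → ι) (hinj : Injective e')
    (h : ∀ l, e' l ∉ range e →
      ∃ p ∈ F, ∃ q ∈ F, (∀ l' ≠ l, p (e' l') = q (e' l')) ∧ p (e' l) ≠ q (e' l)) :
    IsChart F e' := by
  classical
  -- Induction on the number of coordinates of `e'` missing from the chart.
  induction hN : (Finset.univ.filter fun l => e' l ∉ range e).card using Nat.strong_induction_on
    generalizing e with
  | _ N ih =>
    by_cases hall : ∀ l, e' l ∈ range e
    · choose σ hσ using hall
      have hσi : Injective σ := fun a b hab => hinj (by rw [← hσ a, ← hσ b, hab])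
      have : e' = e ∘ Equiv.ofBijective σ (Finite.injective_iff_bijective.1 hσi) := by
        ext l; simp [hσ]
      rw [this]
      exact he.comp_perm _
    · push Not at hall
      obtain ⟨l₀, hl₀⟩ := hall
      -- Otherwise `e' l₀` would be a function of the coordinates of `e` that belong to `e'`. None
      -- of these is `e' l₀` itself, so it could not move while the rest of `e'` is fixed.
      have hex : ∃ m, e m ∉ range e' ∧
          ∃ p ∈ F, ∃ q ∈ F, (∀ l ≠ m, p (e l) = q (e l)) ∧ p (e' l₀) ≠ q (e' l₀) := by
        by_contra! hcon
        obtain ⟨p, hp, q, hq, hpq, hne⟩ := h l₀ hl₀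
        refine hne (hF.eq_of_indep he (Finset.univ.filter fun m => e m ∉ range e') (e' l₀)
          (fun m hm => hcon m (Finset.mem_filter.1 hm).2) hp hq fun l hl => ?_)
        have : e l ∈ range e' := by simpa using hl
        obtain ⟨l', hl'⟩ := this
        rw [← hl']
        refine hpq l' ?_
        rintro rfl
        exact hl₀ ⟨l, hl'.symm⟩
      obtain ⟨m, hm, hdep⟩ := hex
      -- The coordinate given up is not in `e'`, so the exchange loses none of those already shared.
      have hmono : ∀ l, e' l ∈ range e → e' l ∈ range (update e m (e' l₀)) := by
        rintro l ⟨m', hm'⟩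
        refine ⟨m', ?_⟩
        rw [update_of_ne, hm']
        rintro rfl
        exact hm ⟨l, hm'.symm⟩
      refine ih _ ?_ (hF.isChart_update he m _ hdep) (fun l hl => h l fun hl' => hl (hmono l hl'))
        rfl
      rw [← hN]
      refine Finset.card_lt_card (Finset.ssubset_iff_of_subset ?_ |>.2 ⟨l₀, ?_, ?_⟩)
      · intro l hl
        simp only [Finset.mem_filter, Finset.mem_univ, true_and] at hl ⊢
        exact fun hl' => hl (hmono l hl')
      · simpa using hl₀
      · simp only [Finset.mem_filter, Finset.mem_univ, true_and, not_not]
        exact ⟨m, update_self ..⟩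

end Charts

/-! ### Slices, dimension, and intersections with cones -/

section Slices

variable {ι : Type*} {d : ℕ} {F : Set (ι → ℝ)}

theorem IsChart.slice {e : Fin (d + 1) → ι} (he : IsChart F e) (m : Fin (d + 1)) (c : ℝ) :
    IsChart (F ∩ {p | p (e m) = c}) (e ∘ m.succAbove) := by
  have hins : ∀ p : ι → ℝ, p (e m) = c →
      (m.insertNth c (p ∘ (e ∘ m.succAbove)) : Fin (d + 1) → ℝ) = p ∘ e := by
    intro p hp
    rw [Fin.insertNth_eq_iff]
    exact ⟨hp.symm, rfl⟩
  refine ⟨fun p hp q hq hpq => he.1 hp.1 hq.1 ?_, fun p hp N hN => ?_⟩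
  · simp only [← hins p hp.2, ← hins q hq.2]
    exact congrArg (fun w => (m.insertNth c w : Fin (d + 1) → ℝ)) hpq
  · have hc : Continuous fun w : Fin d → ℝ => (m.insertNth c w : Fin (d + 1) → ℝ) :=
      continuous_const.finInsertNth m continuous_id
    have h1 := hc.continuousAt (x := p ∘ (e ∘ m.succAbove))
    filter_upwards [h1.preimage_mem_nhds (by rw [hins p hp.2]; exact he.2 p hp.1 N hN)]
    rintro w ⟨q, ⟨hq, hqN⟩, hqw⟩
    have h2 : (m.insertNth c w : Fin (d + 1) → ℝ) = q ∘ e := hqw.symm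
    rw [Fin.insertNth_eq_iff] at h2
    exact ⟨q, ⟨⟨hq, h2.1.symm⟩, hqN⟩, h2.2.symm⟩

theorem inter_agreeSet_inter_coord (J : Finset ι) (q : ι → ℝ) (z : ι) (c : ℝ) :
    agreeSet J q ∩ {p | p z = c} = ∅ ∨
      ∃ J' q', agreeSet J q ∩ {p | p z = c} = agreeSet (ι := ι) J' q' := by
  classical
  rcases eq_empty_or_nonempty (agreeSet J q ∩ {p | p z = c}) with h | ⟨p₀, h₁, h₂⟩
  · exact Or.inl h
  refine Or.inr ⟨insert z J, p₀, ?_⟩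
  ext p
  simp only [agreeSet, mem_inter_iff, mem_ofPred_eq, Finset.forall_mem_insert]
  rw [← h₂.out, and_comm]
  exact and_congr Iff.rfl (forall₂_congr fun j hj => by rw [h₁ j hj])

/-- Coordinates that can be moved one at a time on a slice form a chart together with the
sliced coordinate. -/
theorem IsRegular.isChart_cons (hF : IsRegular (d + 1) F) {z : ι} {c : ℝ}
    (hz : ∃ p ∈ F, ∃ q ∈ F, p z ≠ q z) (e' : Fin d → ι)
    (h : ∀ l, ∃ p ∈ F ∩ {p | p z = c}, ∃ q ∈ F ∩ {p | p z = c},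
      (∀ l' ≠ l, p (e' l') = q (e' l')) ∧ p (e' l) ≠ q (e' l)) :
    IsChart F (Fin.cons z e' : Fin (d + 1) → ι) := by
  -- Starting from a chart that contains `z` exempts `z` from the test in `isChart_of_exists_ne`; it
  -- is constant on the slice, where the other coordinates are tested.
  obtain ⟨e, m, he, hm⟩ := hF.exists_chart_mem hz
  refine hF.isChart_of_exists_ne he _ ?_ ?_
  · rw [Fin.cons_injective_iff]
    constructor
    · rintro ⟨l, rfl⟩
      obtain ⟨p, hp, q, hq, -, hne⟩ := h l
      exact hne (hp.2.out.trans hq.2.out.symm)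
    · intro l l' hll
      by_contra hne
      obtain ⟨p, -, q, -, hpq, hpq'⟩ := h l
      exact hpq' (by rw [hll]; exact hpq l' (Ne.symm hne))
  · intro l
    refine Fin.cases (fun hl => absurd ⟨m, by simpa using hm⟩ hl) (fun l _ => ?_) l
    obtain ⟨p, hp, q, hq, hpq, hne⟩ := h l
    refine ⟨p, hp.1, q, hq.1, fun l' => ?_, by simpa using hne⟩
    refine Fin.cases (fun _ => ?_) (fun l' hl' => ?_) l'
    · simpa using hp.2.out.trans hq.2.out.symm
    · simpa using hpq l' (by simpa using hl')

/-- If the projection of the slice to `e'` has interior points, each of these coordinates can be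
moved alone within the slice. So `z` and `e'` form a chart of `F`, and injectivity is inherited by
the slice. -/
theorem IsRegular.slice (hF : IsRegular (d + 1) F) {z : ι} {c : ℝ}
    (hz : ∃ p ∈ F, ∃ q ∈ F, p z ≠ q z) (hc : (F ∩ {p | p z = c}).Nonempty) :
    IsRegular d (F ∩ {p | p z = c}) := by
  refine ⟨hc, ?_, fun J q => ?_, fun e' he' => ?_⟩
  · obtain ⟨e, m, he, rfl⟩ := hF.exists_chart_mem hz
    exact ⟨_, he.slice m c⟩
  · rw [inter_assoc, inter_comm _ (agreeSet J q)]
    rcases inter_agreeSet_inter_coord J q z c with h | ⟨J', q', h⟩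
    · rw [h, inter_empty]; exact isPreconnected_empty
    · rw [h]; exact hF.sections J' q'
  · have hch := hF.isChart_cons hz e' (exists_ne_of_interior_nonempty he')
    intro p hp q hq hpq
    refine hch.1 hp.1 hq.1 ?_
    ext l
    refine Fin.cases ?_ (fun l => ?_) l
    · simpa using hp.2.out.trans hq.2.out.symm
    · simpa using congrFun hpq l

theorem IsRegular.subsingleton (hF : IsRegular 0 F) : F.Subsingleton := by
  obtain ⟨e, he⟩ := hF.exists_chart
  exact fun p hp q hq => he.1 hp hq (Subsingleton.elim _ _)

/-- The number of coordinates on which the projection of `F` is injective is at least the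
dimension of `F`. -/
theorem IsRegular.le_of_injOn {r : ℕ} (hF : IsRegular d F) {e : Fin r → ι}
    (he : InjOn (fun p : ι → ℝ => p ∘ e) F) : d ≤ r := by
  induction r generalizing d F with
  | zero =>
    by_contra! hd
    obtain ⟨e', he'⟩ := hF.exists_chart
    obtain ⟨p, hp, q, hq, -, hne⟩ := exists_ne_of_interior_nonempty
      (he'.interior_nonempty hF.nonempty) ⟨0, hd⟩
    exact hne (by rw [he hp hq (Subsingleton.elim _ _)])
  | succ r ih =>
    have htail : ∀ p q : ι → ℝ, p (e 0) = q (e 0) → p ∘ (e ∘ Fin.succ) = q ∘ (e ∘ Fin.succ) →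
        p ∘ e = q ∘ e := by
      intro p q h0 h
      ext l
      exact Fin.cases h0 (fun l => congrFun h l) l
    -- Slicing along a varying `e 0` lowers both `d` and `r`; a constant `e 0` can be dropped,
    -- lowering `r` only.
    by_cases hz : ∃ p ∈ F, ∃ q ∈ F, p (e 0) ≠ q (e 0)
    · obtain ⟨p, hp, -⟩ := id hz
      cases d with
      | zero => exact Nat.zero_le _
      | succ d =>
        refine Nat.succ_le_succ (ih (hF.slice (c := p (e 0)) hz ⟨p, hp, rfl⟩)
          (e := e ∘ Fin.succ) fun p hp q hq hpq => ?_)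
        exact he hp.1 hq.1 (htail p q (hp.2.out.trans hq.2.out.symm) hpq)
    · push Not at hz
      exact (ih hF (e := e ∘ Fin.succ) fun p hp q hq hpq =>
        he hp hq (htail p q (hz p hp q hq) hpq)).trans (Nat.le_succ r)

/-- Each injective projection to the right number of coordinates is a chart. -/
theorem IsRegular.isChart_of_injOn (hF : IsRegular d F) {e : Fin d → ι}
    (he : InjOn (fun p : ι → ℝ => p ∘ e) F) : IsChart F e := by
  induction d generalizing F with
  | zero =>
    obtain ⟨e', he'⟩ := hF.exists_chart
    rwa [Subsingleton.elim e e']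
  | succ d ih =>
    have htail : ∀ p q : ι → ℝ, p (e 0) = q (e 0) → p ∘ (e ∘ Fin.succ) = q ∘ (e ∘ Fin.succ) →
        p ∘ e = q ∘ e := by
      intro p q h0 h
      ext l
      exact Fin.cases h0 (fun l => congrFun h l) l
    -- Were `e 0` constant, the other `d` coordinates would be injective on a set of dimension `d +
    -- 1`.
    have hz : ∃ p ∈ F, ∃ q ∈ F, p (e 0) ≠ q (e 0) := by
      by_contra! hz
      have := hF.le_of_injOn (e := e ∘ Fin.succ) fun p hp q hq hpq =>
        he hp hq (htail p q (hz p hp q hq) hpq)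
      omega
    obtain ⟨p, hp, -⟩ := id hz
    have hS := hF.slice (c := p (e 0)) hz ⟨p, hp, rfl⟩
    have hch := ih hS (e := e ∘ Fin.succ) fun p hp q hq hpq =>
      he hp.1 hq.1 (htail p q (hp.2.out.trans hq.2.out.symm) hpq)
    have := hF.isChart_cons hz _
      (exists_ne_of_interior_nonempty (hch.interior_nonempty hS.nonempty))
    rwa [show (Fin.cons (e 0) (e ∘ Fin.succ) : Fin (d + 1) → ι) = e from Fin.cons_self_tail e]
      at this

/-- Whether `e'` is injective on a slice does not depend on the slice. -/
theorem IsRegular.injOn_slice_iff (hF : IsRegular (d + 1) F) {z : ι} {c : ℝ}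
    (hz : ∃ p ∈ F, ∃ q ∈ F, p z ≠ q z) (hc : (F ∩ {p | p z = c}).Nonempty) {e' : Fin d → ι} :
    InjOn (fun p : ι → ℝ => p ∘ e') (F ∩ {p | p z = c}) ↔
      IsChart F (Fin.cons z e' : Fin (d + 1) → ι) := by
  have hS := hF.slice hz hc
  constructor
  · intro h
    exact hF.isChart_cons hz e' (exists_ne_of_interior_nonempty
      ((hS.isChart_of_injOn h).interior_nonempty hc))
  · intro hch p hp q hq hpq
    refine hch.1 hp.1 hq.1 ?_
    ext l
    refine Fin.cases ?_ (fun l => ?_) l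
    · simpa using hp.2.out.trans hq.2.out.symm
    · simpa using congrFun hpq l

/-- Sections of regular sets by affine coordinate subspaces are regular. -/
theorem IsRegular.inter_agreeSet (hF : IsRegular d F) (J : Finset ι) (q : ι → ℝ)
    (hne : (F ∩ agreeSet J q).Nonempty) : ∃ d', IsRegular d' (F ∩ agreeSet J q) := by
  classical
  induction J using Finset.induction_on with
  | empty => exact ⟨d, by simpa [agreeSet] using hF⟩
  | insert z J hz ih =>
    have heq : F ∩ agreeSet (insert z J) q = F ∩ agreeSet J q ∩ {p | p z = q z} := by
      ext p
      simp only [agreeSet, mem_inter_iff, mem_ofPred_eq, Finset.forall_mem_insert]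
      tauto
    rw [heq] at hne ⊢
    obtain ⟨d', hd'⟩ := ih (hne.mono inter_subset_left)
    by_cases hc : ∃ p ∈ F ∩ agreeSet J q, ∃ p' ∈ F ∩ agreeSet J q, p z ≠ p' z
    · cases d' with
      | zero =>
        obtain ⟨p, hp, p', hp', h⟩ := hc
        exact absurd (by rw [hd'.subsingleton hp hp']) h
      | succ d' => exact ⟨d', hd'.slice hc hne⟩
    · push Not at hc
      obtain ⟨p, hp, hpz⟩ := hne
      have hsub : F ∩ agreeSet J q ⊆ {p | p z = q z} := fun p' hp' =>
        (hc p' hp' p hp).trans hpz.out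
      exact ⟨d', by rwa [inter_eq_left.2 hsub]⟩

theorem isOpen_coordSet (j : ι) {σ : Ordering} (hσ : σ ≠ Ordering.eq) (c : ℝ) :
    IsOpen (coordSet j σ c) := by
  cases σ with
  | eq => exact absurd rfl hσ
  | lt =>
    simpa [coordSet, cmp_eq_lt_iff] using isOpen_lt (continuous_apply j) continuous_const
  | gt =>
    simpa [coordSet, cmp_eq_gt_iff] using isOpen_lt continuous_const (continuous_apply j)

theorem mem_coordSet_eq {j : ι} {c : ℝ} {p : ι → ℝ} :
    p ∈ coordSet j Ordering.eq c ↔ p j = c := cmp_eq_eq_iff ..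

/-- Induction on the number of half-spaces. The section `K`, `q` is kept general because the
bounding hyperplane of the new half-space cuts out another such section, subject to one half-space
fewer. -/
theorem IsRegular.isPreconnected_inter_halfSpaces (hF : IsRegular d F) (J : Finset ι)
    (σ : ι → Ordering) (c : ι → ℝ) (hσ : ∀ j ∈ J, σ j ≠ Ordering.eq) (K : Finset ι) (q : ι → ℝ) :
    IsPreconnected (F ∩ agreeSet K q ∩ ⋂ j ∈ J, coordSet j (σ j) (c j)) := by
  classical
  induction J using Finset.induction_on generalizing K q with
  | empty => simpa using hF.sections K q
  | insert z J hz ih =>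
    rw [Finset.forall_mem_insert] at hσ
    set C := ⋂ j ∈ J, coordSet j (σ j) (c j) with hC
    have hCo : IsOpen C := isOpen_biInter_finset fun j hj => isOpen_coordSet j (hσ.2 j hj) (c j)
    set M := F ∩ agreeSet K q with hM
    have hU : IsPreconnected (M ∩ C) := ih hσ.2 K q
    have hG : IsPreconnected (M ∩ C ∩ {p | p z = c z}) := by
      have : M ∩ C ∩ {p | p z = c z} = F ∩ (agreeSet K q ∩ {p | p z = c z}) ∩ C := by
        ext p; simp only [hM, mem_inter_iff]; tauto
      rw [this]
      rcases inter_agreeSet_inter_coord K q z (c z) with h | ⟨J', q', h⟩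
      · rw [h, inter_empty, empty_inter]; exact isPreconnected_empty
      · rw [h]; exact ih hσ.2 J' q'
    rw [Finset.set_biInter_insert, ← hC, inter_comm (coordSet _ _ _), ← inter_assoc]
    rcases eq_empty_or_nonempty M with hMe | hMne
    · rw [hMe, empty_inter, empty_inter]; exact isPreconnected_empty
    -- If `z` varies on `M`, a chart of `M` containing `z` turns `M ∩ C` into an open set cut by a
    -- half-space of Euclidean space. If `z` is constant on `M`, the half-space contains all of `M`
    -- or none of it.
    by_cases hcz : ∃ p ∈ M, ∃ p' ∈ M, p z ≠ p' z
    · obtain ⟨d', hd'⟩ := hF.inter_agreeSet K q hMne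
      obtain ⟨e, m, he, hm⟩ := hd'.exists_chart_mem hcz
      obtain ⟨s, hsc, hsp, hsu⟩ := he.exists_section
      have hpre : ∀ A : Set (ι → ℝ), ((fun p : ι → ℝ => p ∘ e) '' (M ∩ A)) =
          (fun p : ι → ℝ => p ∘ e) '' M ∩ s ⁻¹' A := by
        intro A
        ext u
        constructor
        · rintro ⟨p, hp, rfl⟩
          exact ⟨⟨p, hp.1, rfl⟩, by simpa only [mem_preimage, hsp p hp.1] using hp.2⟩
        · rintro ⟨hu, huA⟩
          exact ⟨s u, ⟨(hsu u hu).1, huA⟩, (hsu u hu).2⟩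
      have hcoord : ∀ A : Set (Fin d' → ℝ), (fun p : ι → ℝ => p ∘ e) '' (M ∩ C) ∩ A =
          (fun p : ι → ℝ => p ∘ e) '' (M ∩ C ∩ (fun p : ι → ℝ => p ∘ e) ⁻¹' A) := fun A =>
        (image_inter_preimage _ _ _).symm
      have hVo : IsOpen ((fun p : ι → ℝ => p ∘ e) '' (M ∩ C)) := by
        rw [hpre]
        exact hsc.isOpen_inter_preimage he.isOpen_image hCo
      have hcont := (continuous_comp_coord (ι := ι) e)
      have key := isPreconnected_inter_coordSet hVo m (c z) hσ.1 (hU.image _ hcont.continuousOn)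
        (by
          rw [hcoord]
          have : (fun p : ι → ℝ => p ∘ e) ⁻¹' {w | w m = c z} = {p | p z = c z} := by
            ext p; simp [hm]
          rw [this]
          exact hG.image _ hcont.continuousOn)
      have h1 : (fun p : ι → ℝ => p ∘ e) ⁻¹' coordSet m (σ z) (c z) = coordSet z (σ z) (c z) := by
        ext p; simp [coordSet, hm]
      rw [hcoord, h1, inter_assoc, hpre] at key
      have h2 := key.image s (hsc.mono inter_subset_left)
      rw [← hpre, ← image_comp] at h2
      have h3 : (s ∘ fun p : ι → ℝ => p ∘ e) '' (M ∩ (C ∩ coordSet z (σ z) (c z))) =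
          M ∩ (C ∩ coordSet z (σ z) (c z)) := by
        ext p
        constructor
        · rintro ⟨p', hp', rfl⟩
          simpa only [comp_apply, hsp p' hp'.1] using hp'
        · exact fun hp => ⟨p, hp, hsp p hp.1⟩
      rwa [h3, ← inter_assoc] at h2
    · push Not at hcz
      obtain ⟨p₀, hp₀⟩ := hMne
      by_cases h0 : p₀ ∈ coordSet z (σ z) (c z)
      · rw [inter_eq_left.2 fun p hp => ?_]
        · exact hU
        · simpa [coordSet, hcz p hp.1 p₀ hp₀] using h0
      · rw [(disjoint_left.2 fun p hp hp' => h0 ?_ :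
          Disjoint (M ∩ C) (coordSet z (σ z) (c z))).inter_eq]
        · exact isPreconnected_empty
        · simpa [coordSet, hcz p hp.1 p₀ hp₀] using hp'

/-- Intersections of regular sets with coordinate cones are connected. -/
theorem IsRegular.isPreconnected_inter_cone (hF : IsRegular d F) {C : Set (ι → ℝ)}
    (hC : IsCoordCone C) : IsPreconnected (F ∩ C) := by
  classical
  obtain ⟨J, σ, c, rfl⟩ := hC
  have := hF.isPreconnected_inter_halfSpaces (J.filter fun j => σ j ≠ Ordering.eq) σ c
    (fun j hj => (Finset.mem_filter.1 hj).2) (J.filter fun j => σ j = Ordering.eq) c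
  convert this using 1
  rw [inter_assoc]
  congr 1
  ext p
  simp only [agreeSet, mem_inter_iff, mem_iInter, mem_ofPred_eq, Finset.mem_filter]
  constructor
  · refine fun h => ⟨fun j hj => ?_, fun j hj => h j hj.1⟩
    have := h j hj.1
    rwa [hj.2, mem_coordSet_eq] at this
  · rintro ⟨h1, h2⟩ j hj
    by_cases hσ : σ j = Ordering.eq
    · rw [hσ, mem_coordSet_eq]; exact h1 j ⟨hj, hσ⟩
    · exact h2 j ⟨hj, hσ⟩

end Slices

/-! ### Dropping and relabelling coordinates -/

section Reindexing

variable {ι κ : Type*} {d : ℕ} {F : Set (ι → ℝ)} {ε : κ → ι}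

theorem IsChart.reindex {e : Fin d → κ} (he : IsChart F (ε ∘ e)) :
    IsChart ((fun p : ι → ℝ => p ∘ ε) '' F) e := by
  refine ⟨?_, ?_⟩
  · rintro _ ⟨p, hp, rfl⟩ _ ⟨q, hq, rfl⟩ h
    simp only [he.1 hp hq h]
  · rintro _ ⟨p, hp, rfl⟩ N hN
    refine mem_of_superset (he.2 p hp _
      ((continuous_comp_coord ε).continuousAt.preimage_mem_nhds hN)) ?_
    rintro _ ⟨q, ⟨hq, hqN⟩, rfl⟩
    exact ⟨_, ⟨⟨q, hq, rfl⟩, hqN⟩, rfl⟩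

theorem IsRegular.reindex (hF : IsRegular d F) (hε : Injective ε) {e : Fin d → κ}
    (he : IsChart F (ε ∘ e)) : IsRegular d ((fun p : ι → ℝ => p ∘ ε) '' F) := by
  classical
  refine ⟨hF.nonempty.image _, ⟨e, he.reindex⟩, fun J q => ?_, fun e' he' => ?_⟩
  -- The default value `0` of the extension is never read, since only labels in the range of `ε` are
  -- constrained.
  · have : (fun p : ι → ℝ => p ∘ ε) '' F ∩ agreeSet J q =
        (fun p : ι → ℝ => p ∘ ε) '' (F ∩ agreeSet (J.image ε) (extend ε q 0)) := by
      ext w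
      constructor
      · rintro ⟨⟨p, hp, rfl⟩, hw⟩
        refine ⟨p, ⟨hp, fun j hj => ?_⟩, rfl⟩
        obtain ⟨l, hl, rfl⟩ := Finset.mem_image.1 hj
        rw [hε.extend_apply]
        exact hw l hl
      · rintro ⟨p, ⟨hp, hpa⟩, rfl⟩
        refine ⟨⟨p, hp, rfl⟩, fun j hj => ?_⟩
        have := hpa _ (Finset.mem_image_of_mem ε hj)
        rwa [hε.extend_apply] at this
    rw [this]
    exact (hF.sections _ _).image _ (continuous_comp_coord ε).continuousOn
  · rw [← image_comp] at he'
    have := hF.injOn (ε ∘ e') he'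
    rintro _ ⟨p, hp, rfl⟩ _ ⟨q, hq, rfl⟩ h
    simp only [this hp hq h]

end Reindexing

/-! ### Graphs of maps as regular sets -/

section MapGraph

variable {n k : ℕ} {X : Set (Fin n → ℝ)} {f : (Fin n → ℝ) → Fin k → ℝ}

theorem mem_mapGraph {p : Fin n ⊕ Fin k → ℝ} :
    p ∈ mapGraph X f ↔ p ∘ Sum.inl ∈ X ∧ p ∘ Sum.inr = f (p ∘ Sum.inl) := by
  constructor
  · rintro ⟨x, hx, rfl⟩
    exact ⟨hx, rfl⟩
  · rintro ⟨h1, h2⟩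
    exact ⟨_, h1, by simp only; rw [← h2, Sum.elim_comp_inl_inr]⟩

theorem elim_mem_mapGraph {x : Fin n → ℝ} (hx : x ∈ X) :
    (Sum.elim x (f x) : Fin n ⊕ Fin k → ℝ) ∈ mapGraph X f := ⟨x, hx, rfl⟩

theorem image_inl_mapGraph :
    (fun p : Fin n ⊕ Fin k → ℝ => p ∘ Sum.inl) '' mapGraph X f = X := by
  ext x
  constructor
  · rintro ⟨_, ⟨x, hx, rfl⟩, rfl⟩
    exact hx
  · exact fun hx => ⟨_, elim_mem_mapGraph hx, rfl⟩

theorem continuousOn_elim (hf : ContinuousOn f X) :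
    ContinuousOn (fun x => (Sum.elim x (f x) : Fin n ⊕ Fin k → ℝ)) X := by
  refine continuousOn_pi.2 fun l => ?_
  cases l with
  | inl l => exact (continuous_apply l).continuousOn
  | inr l => exact (continuous_apply l).comp_continuousOn hf

theorem isChart_inl (hX : IsOpen X) (hf : ContinuousOn f X) :
    IsChart (mapGraph X f) (Sum.inl : Fin n → Fin n ⊕ Fin k) := by
  refine IsChart.of_section (s := fun x => Sum.elim x (f x)) ?_ ?_ ?_
  · rwa [image_inl_mapGraph]
  · rw [image_inl_mapGraph]
    exact continuousOn_elim hf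
  · rintro _ ⟨x, -, rfl⟩
    rfl

theorem exists_mapGraph_eq {F : Set (Fin n ⊕ Fin k → ℝ)} (hF : IsChart F Sum.inl) :
    ∃ (X : Set (Fin n → ℝ)) (f : (Fin n → ℝ) → Fin k → ℝ), mapGraph X f = F := by
  obtain ⟨s, -, hsp, hsu⟩ := hF.exists_section
  refine ⟨(fun p => p ∘ Sum.inl) '' F, fun x => s x ∘ Sum.inr, ?_⟩
  ext p
  rw [mem_mapGraph]
  constructor
  · rintro ⟨h1, h2⟩
    rw [← Sum.elim_comp_inl_inr p, h2]
    nth_rw 1 [← (hsu _ h1).2]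
    rw [Sum.elim_comp_inl_inr]
    exact (hsu _ h1).1
  · intro hp
    exact ⟨⟨p, hp, rfl⟩, by rw [hsp p hp]⟩

theorem continuousOn_of_isChart (hF : IsChart (mapGraph X f) Sum.inl) : ContinuousOn f X := by
  obtain ⟨s, hsc, hsp, -⟩ := hF.exists_section
  rw [image_inl_mapGraph] at hsc
  have h1 : ContinuousOn (fun x => s x ∘ Sum.inr) X :=
    (continuous_comp_coord Sum.inr).comp_continuousOn hsc
  refine h1.congr fun x hx => ?_
  exact (congrArg (· ∘ Sum.inr) (hsp _ (elim_mem_mapGraph hx))).symm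

theorem isBounded_image_comp {ι κ : Type*} [Fintype ι] [Fintype κ] {F : Set (ι → ℝ)}
    (hF : Bornology.IsBounded F) (e : κ → ι) :
    Bornology.IsBounded ((fun p : ι → ℝ => p ∘ e) '' F) := by
  rw [← Bornology.forall_isBounded_image_eval_iff] at hF ⊢
  intro i
  rw [← image_comp]
  exact hF (e i)

theorem isBounded_mapGraph (hX : Bornology.IsBounded X) (hf : Bornology.IsBounded (f '' X)) :
    Bornology.IsBounded (mapGraph X f) := by
  rw [← Bornology.forall_isBounded_image_eval_iff] at hX hf ⊢
  intro l
  rw [mapGraph, ← image_comp]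
  cases l with
  | inl l => exact hX l
  | inr l =>
    have := hf l
    rwa [← image_comp] at this

theorem isBounded_image_of_mapGraph (hF : Bornology.IsBounded (mapGraph X f)) :
    Bornology.IsBounded (f '' X) := by
  have := isBounded_image_comp hF Sum.inr
  rwa [mapGraph, ← image_comp] at this

theorem isBounded_of_mapGraph (hF : Bornology.IsBounded (mapGraph X f)) :
    Bornology.IsBounded X := by
  rw [← image_inl_mapGraph (X := X) (f := f)]
  exact isBounded_image_comp hF Sum.inl

theorem injOn_restrict_iff {ι : Type*} {d : ℕ} {H : Finset ι} {e : Fin d → ι}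
    (he : range e = H) {A : Set (ι → ℝ)} :
    InjOn (H.restrict : (ι → ℝ) → H → ℝ) A ↔ InjOn (fun p : ι → ℝ => p ∘ e) A := by
  have h : ∀ p q : ι → ℝ, (H.restrict p : H → ℝ) = H.restrict q ↔ p ∘ e = q ∘ e := by
    intro p q
    constructor
    · intro h
      ext l
      have hl : e l ∈ H := by rw [← Finset.mem_coe, ← he]; exact mem_range_self l
      exact congrFun h ⟨e l, hl⟩
    · intro h
      ext ⟨j, hj⟩
      rw [← Finset.mem_coe, ← he] at hj
      obtain ⟨l, rfl⟩ := hj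
      exact congrFun h l
  exact forall₂_congr fun p _ => forall₂_congr fun q _ => by rw [h p q]

theorem injOn_elim_iff {H : Finset (Fin n ⊕ Fin k)} :
    InjOn (fun x => H.restrict (Sum.elim x (f x) : Fin n ⊕ Fin k → ℝ)) X ↔
      InjOn (H.restrict : (Fin n ⊕ Fin k → ℝ) → H → ℝ) (mapGraph X f) := by
  constructor
  · rintro h _ ⟨x, hx, rfl⟩ _ ⟨y, hy, rfl⟩ hxy
    rw [h hx hy hxy]
  · intro h x hx y hy hxy
    exact congrArg (fun p : Fin n ⊕ Fin k → ℝ => p ∘ Sum.inl)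
      (h (elim_mem_mapGraph hx) (elim_mem_mapGraph hy) hxy)

theorem exists_range_eq {ι : Type*} {d : ℕ} {H : Finset ι} (h : H.card = d) :
    ∃ e : Fin d → ι, range e = H := by
  refine ⟨fun l => ((H.equivFinOfCardEq h).symm l : ι), ?_⟩
  ext j
  constructor
  · rintro ⟨l, rfl⟩
    exact ((H.equivFinOfCardEq h).symm l).2
  · exact fun hj => ⟨H.equivFinOfCardEq h ⟨j, hj⟩, by simp⟩

theorem hasDim_image_restrict {ι : Type*} {F : Set (ι → ℝ)} {e : Fin n → ι}
    (hinj : Injective e) {H : Finset ι} (hH : range e = H) (hcard : H.card = n)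
    (h : (interior ((fun p : ι → ℝ => p ∘ e) '' F)).Nonempty) :
    HasDim ((H.restrict : (ι → ℝ) → H → ℝ) '' F) n := by
  have hmem : ∀ l, e l ∈ H := fun l => by rw [← Finset.mem_coe, ← hH]; exact mem_range_self l
  -- The set of all `n` labels in `H` witnesses dimension `n`, and no subset of `H` has more labels.
  refine ⟨⟨Finset.univ, by simp [hcard], ?_⟩, ?_⟩
  · let E : Fin n → (Finset.univ : Finset H) := fun l => ⟨⟨e l, hmem l⟩, Finset.mem_univ _⟩
    have hE : Bijective E := by
      constructor
      · intro a b hab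
        exact hinj (congrArg (fun j : (Finset.univ : Finset H) => (j : ι)) hab)
      · rintro ⟨⟨j, hj⟩, hju⟩
        have hj' := hj
        rw [← Finset.mem_coe, ← hH] at hj'
        obtain ⟨l, rfl⟩ := hj'
        exact ⟨l, rfl⟩
    let E' := Equiv.ofBijective E hE
    obtain ⟨w, hw⟩ := h
    have hEw : (w ∘ E'.symm) ∘ E = w := by
      ext l
      exact congrArg w (E'.symm_apply_apply l)
    refine ⟨w ∘ E'.symm, mem_interior_iff_mem_nhds.2 ?_⟩
    have hc := (continuous_comp_coord E).continuousAt (x := w ∘ E'.symm)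
    rw [mem_interior_iff_mem_nhds] at hw
    filter_upwards [hc.preimage_mem_nhds (by rwa [hEw])]
    rintro v ⟨p, hp, hpv⟩
    refine ⟨_, ⟨p, hp, rfl⟩, ?_⟩
    ext j
    obtain ⟨l, rfl⟩ := hE.2 j
    exact congrFun hpv l
  · rintro m ⟨J, rfl, -⟩
    exact (Finset.card_le_univ J).trans_eq (by simp [hcard])

theorem agreeSet_isAffineCoordSubspace {ι : Type*} (J : Finset ι) (q : ι → ℝ) :
    IsAffineCoordSubspace (agreeSet J q) := by
  refine ⟨J, q, ?_⟩
  ext p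
  simp [agreeSet, mem_coordSet_eq]

theorem IsAffineCoordSubspace.exists_eq_agreeSet {ι : Type*} {S : Set (ι → ℝ)}
    (hS : IsAffineCoordSubspace S) : ∃ J q, S = agreeSet J q := by
  obtain ⟨J, q, rfl⟩ := hS
  refine ⟨J, q, ?_⟩
  ext p
  simp [agreeSet, mem_coordSet_eq]

/-- Quasi-affineness enters in one direction only: an image of full dimension forces injectivity. -/
theorem isRegular_mapGraph (hXo : IsOpen X) (hXne : X.Nonempty) (hf : ContinuousOn f X)
    (hqa : IsQuasiAffine X f)
    (h : ∀ S : Set (Fin n ⊕ Fin k → ℝ), IsAffineCoordSubspace S →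
      IsPreconnected (mapGraph X f ∩ S)) : IsRegular n (mapGraph X f) := by
  classical
  refine ⟨hXne.image _, ⟨_, isChart_inl hXo hf⟩,
    fun J q => h _ (agreeSet_isAffineCoordSubspace J q), fun e he => ?_⟩
  -- A repeated label could not be moved alone, so the image would have no interior points.
  have hinj : Injective e := by
    intro l l' hll
    by_contra hne
    obtain ⟨p, -, q, -, hpq, hpq'⟩ := exists_ne_of_interior_nonempty he l
    exact hpq' (by rw [hll]; exact hpq l' (Ne.symm hne))
  have hH : range e = (Finset.univ.image e : Finset (Fin n ⊕ Fin k)) := by simp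
  have hcard : (Finset.univ.image e).card = n := by
    rw [Finset.card_image_of_injective _ hinj, Finset.card_univ, Fintype.card_fin]
  exact (injOn_restrict_iff hH).1
    ((hqa _ hcard).2 (hasDim_image_restrict hinj hH hcard he))

/-- Conditions on the values of `f` are conditions on the `y` coordinates, so the set is the
projection of the intersection of the graph with one cone. This is the source of semi-monotonicity
of `X` and of its sublevel and superlevel sets. -/
theorem IsRegular.isPreconnected_domain {d : ℕ} (hF : IsRegular d (mapGraph X f))
    (J : Finset (Fin n)) (σ : Fin n → Ordering) (c : Fin n → ℝ) (K : Finset (Fin k))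
    (τ : Fin k → Ordering) (c' : Fin k → ℝ) :
    IsPreconnected ({x | x ∈ X ∧ ∀ i ∈ K, cmp (f x i) (c' i) = τ i} ∩
      ⋂ j ∈ J, coordSet j (σ j) (c j)) := by
  have h := (hF.isPreconnected_inter_cone ⟨J.disjSum K, Sum.elim σ τ, Sum.elim c c', rfl⟩).image
    (fun p : Fin n ⊕ Fin k → ℝ => p ∘ Sum.inl) (continuous_comp_coord _).continuousOn
  convert h using 1
  ext x
  simp only [mem_inter_iff, mem_ofPred_eq, mem_iInter, coordSet, mem_image]
  constructor
  · rintro ⟨⟨hx, h1⟩, h2⟩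
    refine ⟨_, ⟨elim_mem_mapGraph hx, ?_⟩, rfl⟩
    rintro (j | i) hj
    · exact h2 j (by simpa using hj)
    · exact h1 i (by simpa using hj)
  · rintro ⟨_, ⟨⟨x, hx, rfl⟩, h1⟩, rfl⟩
    exact ⟨⟨hx, fun i hi => h1 (Sum.inr i) (by simpa using hi)⟩,
      fun j hj => h1 (Sum.inl j) (by simpa using hj)⟩

theorem IsRegular.isSemiMonotone {d : ℕ} (hF : IsRegular d (mapGraph X f)) (hX : IsOpen X)
    (hXb : Bornology.IsBounded X) : IsSemiMonotone X := by
  refine ⟨hX, hXb, ?_⟩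
  rintro _ ⟨J, σ, c, rfl⟩
  simpa using hF.isPreconnected_domain J σ c ∅ (fun _ => Ordering.eq) 0

theorem IsRegular.isAdmissible (hb : Bornology.IsBounded (mapGraph X f))
    (hF : IsRegular n (mapGraph X f)) (hc : IsChart (mapGraph X f) Sum.inl) :
    IsAdmissible X f := by
  have hXo : IsOpen X := by
    have := hc.isOpen_image
    rwa [image_inl_mapGraph] at this
  refine ⟨?_, hF.isSemiMonotone hXo (isBounded_of_mapGraph hb), continuousOn_of_isChart hc,
    isBounded_image_of_mapGraph hb⟩
  have := hF.nonempty
  rwa [mapGraph, image_nonempty] at this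

theorem IsRegular.isSubmonotone (hb : Bornology.IsBounded (mapGraph X f))
    (hF : IsRegular n (mapGraph X f)) (hc : IsChart (mapGraph X f) Sum.inl) (i : Fin k) :
    IsSubmonotone X (fun x => f x i) ∧ IsSupermonotone X (fun x => f x i) := by
  obtain ⟨hne, hX, hf, hfb⟩ := hF.isAdmissible hb hc
  have hfi : ContinuousOn (fun x => f x i) X := (continuous_apply i).comp_continuousOn hf
  have hfib : Bornology.IsBounded ((fun x => f x i) '' X) := by
    have := hfb.image_eval i
    rwa [← image_comp] at this
  refine ⟨⟨hne, hX, hfib, hfi.upperSemicontinuousOn, fun b => ⟨?_, ?_, ?_⟩⟩,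
    ⟨hne, hX, ?_, hfi.neg.upperSemicontinuousOn, fun b => ⟨?_, ?_, ?_⟩⟩⟩
  · exact hfi.isOpen_inter_preimage hX.1 isOpen_Iio
  · exact hX.2.1.subset fun x hx => hx.1
  · rintro _ ⟨J, σ, c, rfl⟩
    simpa [cmp_eq_lt_iff] using
      hF.isPreconnected_domain J σ c {i} (fun _ => Ordering.lt) (fun _ => b)
  · have := hfib.neg
    rwa [← image_neg_eq_neg, ← image_comp] at this
  · exact hfi.neg.isOpen_inter_preimage hX.1 isOpen_Iio
  · exact hX.2.1.subset fun x hx => hx.1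
  · rintro _ ⟨J, σ, c, rfl⟩
    simpa [cmp_eq_gt_iff, neg_lt] using
      hF.isPreconnected_domain J σ c {i} (fun _ => Ordering.gt) (fun _ => -b)

/-- A pair violating increase and a pair violating decrease lie in a common compact interval inside
`T`, where the known dichotomy applies. -/
theorem strictMonoOn_or_strictAntiOn_of_ordConnected {T : Set ℝ} (hT : T.OrdConnected)
    {h : ℝ → ℝ} (hc : ContinuousOn h T) (hi : InjOn h T) : StrictMonoOn h T ∨ StrictAntiOn h T := by
  by_contra! hcon
  obtain ⟨h1, h2⟩ := hcon
  simp only [StrictMonoOn, StrictAntiOn] at h1 h2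
  push Not at h1 h2
  obtain ⟨a, ha, b, hb, hab, h1⟩ := h1
  obtain ⟨u, hu, v, hv, huv, h2⟩ := h2
  have hmin : min a u ∈ T := by rcases min_choice a u with h | h <;> rwa [h]
  have hmax : max b v ∈ T := by rcases max_choice b v with h | h <;> rwa [h]
  have hsub := hT.out hmin hmax
  have haI : a ∈ Icc (min a u) (max b v) := ⟨min_le_left _ _, hab.le.trans (le_max_left _ _)⟩
  have hbI : b ∈ Icc (min a u) (max b v) := ⟨(min_le_left _ _).trans hab.le, le_max_left _ _⟩
  have huI : u ∈ Icc (min a u) (max b v) := ⟨min_le_right _ _, huv.le.trans (le_max_right _ _)⟩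
  have hvI : v ∈ Icc (min a u) (max b v) := ⟨(min_le_right _ _).trans huv.le, le_max_right _ _⟩
  rcases (hc.mono hsub).strictMonoOn_of_injOn_Icc' (haI.1.trans haI.2) (hi.mono hsub) with h | h
  · exact absurd (h haI hbI hab) (not_lt.2 h1)
  · exact absurd (h huI hvI huv) (not_lt.2 h2)

end MapGraph

/-! ### One-dimensional domains -/

section DimensionOne

variable {k : ℕ} {X : Set (Fin 1 → ℝ)} {f : (Fin 1 → ℝ) → Fin k → ℝ}

theorem IsRegular.isMonotoneFunction (hb : Bornology.IsBounded (mapGraph X f))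
    (hF : IsRegular 1 (mapGraph X f)) (hc : IsChart (mapGraph X f) Sum.inl) (i : Fin k) :
    IsMonotoneFunction X (fun x => f x i) := by
  obtain ⟨h1, h2⟩ := hF.isSubmonotone hb hc i
  refine ⟨h1, h2, fun j => ?_⟩
  by_cases hind : IndepOf X (fun x => f x i) j
  · exact Or.inr (Or.inr hind)
  simp only [IndepOf] at hind
  push Not at hind
  obtain ⟨x, hx, y, hy, hxy, hne⟩ := hind
  -- A component that is not constant replaces the single chart coordinate, hence is injective on an
  -- interval and strictly monotone.
  have hch := hF.isChart_update hc j (Sum.inr i)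
    ⟨_, elim_mem_mapGraph hx, _, elim_mem_mapGraph hy, hxy, hne⟩
  have hinj : ∀ x ∈ X, ∀ y ∈ X, f x i = f y i → x = y := by
    intro x hx y hy hxy
    refine congrArg (fun p : Fin 1 ⊕ Fin k → ℝ => p ∘ Sum.inl)
      (hch.1 (elim_mem_mapGraph hx) (elim_mem_mapGraph hy) ?_)
    ext l
    rw [Subsingleton.elim l j]
    simpa using hxy
  have hfi : ContinuousOn (fun x => f x i) X :=
    (continuous_apply i).comp_continuousOn (continuousOn_of_isChart hc)
  have hconst : ∀ x : Fin 1 → ℝ, (fun _ => x j) = x := fun x => by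
    ext l; rw [Subsingleton.elim l j]
  have hT : {t : ℝ | (fun _ => t : Fin 1 → ℝ) ∈ X} = (fun x : Fin 1 → ℝ => x j) '' X := by
    ext t
    constructor
    · exact fun ht => ⟨_, ht, rfl⟩
    · rintro ⟨x, hx, rfl⟩
      rwa [mem_ofPred_eq, hconst]
  have hXc : IsPreconnected X := by
    simpa using h1.2.1.2.2 univ ⟨∅, fun _ => Ordering.eq, 0, by simp⟩
  have hTo : {t : ℝ | (fun _ => t : Fin 1 → ℝ) ∈ X}.OrdConnected := by
    rw [hT]
    exact (hXc.image _ (continuous_apply j).continuousOn).ordConnected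
  have hdiag : Continuous fun t : ℝ => (fun _ => t : Fin 1 → ℝ) :=
    continuous_pi fun _ => continuous_id
  have hX' : ∀ x ∈ X, x j ∈ {t : ℝ | (fun _ => t : Fin 1 → ℝ) ∈ X} := fun x hx => by
    rw [hT]; exact ⟨x, hx, rfl⟩
  rcases strictMonoOn_or_strictAntiOn_of_ordConnected hTo
    (h := fun t => f (fun _ => t) i) (hfi.comp hdiag.continuousOn fun t ht => ht)
    (fun t ht t' ht' htt => congrFun (hinj _ ht _ ht' htt) j) with h | h
  · left
    intro x hx y hy _ hlt
    simpa only [hconst] using h (hX' x hx) (hX' y hy) hlt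
  · right; left
    intro x hx y hy _ hlt
    simpa only [hconst] using h (hX' x hx) (hX' y hy) hlt

end DimensionOne

/-! ### Level maps as relabelled slices -/

section LevelSets

variable {n k : ℕ}

/-- The labels of the coordinates of the level map, as labels of the original coordinates. -/
def levelEmb (i : Fin k) (j : Fin (n + 1)) : Fin n ⊕ Fin k → Fin (n + 1) ⊕ Fin k :=
  Sum.elim (Sum.inl ∘ j.succAbove) (update Sum.inr i (Sum.inl j))

/-- The point of the level set `y i = b` with the given coordinates. -/
def levelLift (i : Fin k) (j : Fin (n + 1)) (b : ℝ) (q : Fin n ⊕ Fin k → ℝ) :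
    Fin (n + 1) ⊕ Fin k → ℝ :=
  Sum.elim (j.insertNth (q (Sum.inr i)) (q ∘ Sum.inl) : Fin (n + 1) → ℝ)
    (update (q ∘ Sum.inr) i b)

variable (i : Fin k) (j : Fin (n + 1)) (b : ℝ)

theorem levelEmb_inl (a : Fin n) : levelEmb i j (Sum.inl a) = Sum.inl (j.succAbove a) := rfl

theorem levelEmb_inr_self : levelEmb i j (Sum.inr i) = Sum.inl j := by
  rw [levelEmb, Sum.elim_inr, update_self]

theorem levelEmb_inr {i a : Fin k} (ha : a ≠ i) : levelEmb i j (Sum.inr a) = Sum.inr a := by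
  rw [levelEmb, Sum.elim_inr, update_of_ne ha]

theorem levelLift_inl (q : Fin n ⊕ Fin k → ℝ) (a : Fin (n + 1)) :
    levelLift i j b q (Sum.inl a) =
      (j.insertNth (q (Sum.inr i)) (q ∘ Sum.inl) : Fin (n + 1) → ℝ) a := rfl

theorem levelLift_inr_self (q : Fin n ⊕ Fin k → ℝ) : levelLift i j b q (Sum.inr i) = b := by
  rw [levelLift, Sum.elim_inr, update_self]

theorem levelLift_inr {i a : Fin k} (ha : a ≠ i) (q : Fin n ⊕ Fin k → ℝ) :
    levelLift i j b q (Sum.inr a) = q (Sum.inr a) := by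
  rw [levelLift, Sum.elim_inr, update_of_ne ha, comp_apply]

theorem levelLift_comp_levelEmb (q : Fin n ⊕ Fin k → ℝ) :
    levelLift i j b q ∘ levelEmb i j = q := by
  ext (a | a)
  · simp [levelLift_inl, levelEmb_inl]
  · by_cases ha : a = i
    · subst ha; simp [levelLift_inl, levelEmb_inr_self]
    · simp [levelLift_inr, levelEmb_inr, ha]

theorem levelEmb_injective : Injective (levelEmb i j) := by
  intro a c h
  classical
  have h1 := levelLift_comp_levelEmb i j 0 (Pi.single a 1)
  have ha := congrFun h1 a
  have hc := congrFun h1 c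
  simp only [comp_apply, ← h, Pi.single_eq_same] at ha hc
  by_contra hne
  rw [Pi.single_eq_of_ne (Ne.symm hne)] at hc
  exact one_ne_zero (ha.symm.trans hc)

theorem levelLift_of_comp (p : Fin (n + 1) ⊕ Fin k → ℝ) (hp : p (Sum.inr i) = b) :
    levelLift i j b (p ∘ levelEmb i j) = p := by
  ext (a | a)
  · refine Fin.succAboveCases j ?_ (fun a => ?_) a
    · simp [levelLift_inl, levelEmb_inr_self]
    · simp [levelLift_inl, levelEmb_inl]
  · by_cases ha : a = i
    · subst ha; rw [levelLift_inr_self, hp]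
    · simp [levelLift_inr, levelEmb_inr, ha]

theorem continuous_levelLift : Continuous (levelLift (n := n) i j b) := by
  have h1 : Continuous fun q : Fin n ⊕ Fin k → ℝ =>
      (j.insertNth (q (Sum.inr i)) (q ∘ Sum.inl) : Fin (n + 1) → ℝ) :=
    (continuous_apply (Sum.inr i)).finInsertNth j (continuous_comp_coord Sum.inl)
  have h2 : Continuous fun q : Fin n ⊕ Fin k → ℝ => update (q ∘ Sum.inr) i b :=
    (continuous_comp_coord _).update i continuous_const
  refine continuous_pi fun l => ?_
  cases l with
  | inl l => exact (continuous_apply l).comp h1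
  | inr l => exact (continuous_apply l).comp h2

variable {i j b} {X : Set (Fin (n + 1) → ℝ)} {f : (Fin (n + 1) → ℝ) → Fin k → ℝ}

/-- This form presents the graph of a level map as a relabelled slice, to which the results on
regular sets apply. -/
theorem isLevelMap_iff {X' : Set (Fin n → ℝ)} {g : (Fin n → ℝ) → Fin k → ℝ} :
    IsLevelMap X f i j b X' g ↔
      mapGraph X' g =
        (fun p => p ∘ levelEmb i j) '' (mapGraph X f ∩ {p | p (Sum.inr i) = b}) := by
  have h1 : ∀ q, q ∈ (fun p => p ∘ levelEmb i j) '' (mapGraph X f ∩ {p | p (Sum.inr i) = b}) ↔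
      levelLift i j b q ∈ mapGraph X f := by
    intro q
    constructor
    · rintro ⟨p, ⟨hp, hpb⟩, rfl⟩
      simp only
      rwa [levelLift_of_comp i j b p hpb]
    · intro hq
      exact ⟨_, ⟨hq, levelLift_inr_self i j b q⟩, levelLift_comp_levelEmb i j b q⟩
  rw [Set.ext_iff]
  simp only [h1]
  constructor
  · intro h q
    have := h (q ∘ Sum.inl) (q ∘ Sum.inr)
    rwa [Sum.elim_comp_inl_inr] at this
  · exact fun h x' y' => h (Sum.elim x' y')

theorem exists_ne_of_not_indepOf (h : ¬ IndepOf X (fun x => f x i) j) :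
    ∃ p ∈ mapGraph X f, ∃ q ∈ mapGraph X f,
      (∀ l ≠ j, p (Sum.inl l) = q (Sum.inl l)) ∧ p (Sum.inr i) ≠ q (Sum.inr i) := by
  simp only [IndepOf] at h
  push Not at h
  obtain ⟨x, hx, y, hy, hxy, hne⟩ := h
  exact ⟨_, elim_mem_mapGraph hx, _, elim_mem_mapGraph hy, hxy, hne⟩

/-- Exchange `x j` for `y i` in the chart of the domain coordinates, then slice along `y i`. -/
theorem IsRegular.isChart_level (hF : IsRegular (n + 1) (mapGraph X f))
    (hc : IsChart (mapGraph X f) Sum.inl) (h : ¬ IndepOf X (fun x => f x i) j) :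
    IsChart (mapGraph X f ∩ {p | p (Sum.inr i) = b}) (levelEmb i j ∘ Sum.inl) := by
  have h1 := (hF.isChart_update hc j (Sum.inr i) (exists_ne_of_not_indepOf h)).slice j b
  rw [update_self] at h1
  convert h1 using 1
  ext l
  exact (update_of_ne (Fin.succAbove_ne j l) _ _).symm

/-- The right-hand side does not involve `b`; this yields the constancy of the basis sets in the
definition of monotone maps. -/
theorem IsRegular.basisSets_level (hF : IsRegular (n + 1) (mapGraph X f))
    (h : ¬ IndepOf X (fun x => f x i) j) {X' : Set (Fin n → ℝ)} {g : (Fin n → ℝ) → Fin k → ℝ}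
    (hne : X'.Nonempty) (hg : IsLevelMap X f i j b X' g) {H : Finset (Fin n ⊕ Fin k)}
    {e : Fin n → Fin n ⊕ Fin k} (he : range e = H) :
    InjOn (fun x => H.restrict (Sum.elim x (g x) : Fin n ⊕ Fin k → ℝ)) X' ↔
      IsChart (mapGraph X f) (Fin.cons (Sum.inr i) (levelEmb i j ∘ e) :
        Fin (n + 1) → Fin (n + 1) ⊕ Fin k) := by
  obtain ⟨p, hp, q, hq, -, hpq⟩ := exists_ne_of_not_indepOf h
  rw [isLevelMap_iff] at hg
  have hne' : (mapGraph X f ∩ {p | p (Sum.inr i) = b}).Nonempty := by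
    rw [← image_nonempty, ← hg]
    exact hne.image _
  rw [injOn_elim_iff, injOn_restrict_iff he, hg, ← hF.injOn_slice_iff ⟨p, hp, q, hq, hpq⟩ hne']
  constructor
  · intro hi p hp q hq hpq
    have h1 := hi ⟨p, hp, rfl⟩ ⟨q, hq, rfl⟩ hpq
    rw [← levelLift_of_comp i j b p hp.2, ← levelLift_of_comp i j b q hq.2]
    exact congrArg _ h1
  · rintro hi _ ⟨p, hp, rfl⟩ _ ⟨q, hq, rfl⟩ hpq
    simp only [hi hp hq hpq]

end LevelSets

/-! ### The inductions between regular graphs and monotone maps -/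

variable {k : ℕ}

theorem IsRegular.isMonotoneMap : ∀ (n : ℕ) (X : Set (Fin (n + 1) → ℝ))
    (f : (Fin (n + 1) → ℝ) → Fin k → ℝ), Bornology.IsBounded (mapGraph X f) →
      IsRegular (n + 1) (mapGraph X f) → IsChart (mapGraph X f) Sum.inl →
        IsMonotoneMap (n + 1) X f
  | 0, X, f, hb, hF, hc => by
    rw [IsMonotoneMap]
    exact ⟨hF.isAdmissible hb hc, hF.isMonotoneFunction hb hc⟩
  | n + 1, X, f, hb, hF, hc => by
    rw [IsMonotoneMap]
    refine ⟨hF.isAdmissible hb hc, fun i j hij => ⟨?_, ?_⟩⟩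
    · rintro b ⟨x, hx, hxb⟩
      obtain ⟨p, hp, q, hq, -, hpq⟩ := exists_ne_of_not_indepOf hij
      have hS := hF.slice (c := b) ⟨p, hp, q, hq, hpq⟩ ⟨_, elim_mem_mapGraph hx, hxb⟩
      have hch := hF.isChart_level (b := b) hc hij
      obtain ⟨X', g, hg⟩ := exists_mapGraph_eq hch.reindex
      refine ⟨X', g, isLevelMap_iff.2 hg, IsRegular.isMonotoneMap n X' g ?_ ?_ ?_⟩
      · rw [hg]
        exact isBounded_image_comp (hb.subset inter_subset_left) _
      · rw [hg]
        exact hS.reindex (levelEmb_injective i j) hch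
      · rw [hg]
        exact hch.reindex
    · intro b₁ b₂ X₁ X₂ g₁ g₂ hX₁ hX₂ h₁ h₂
      ext H
      refine and_congr_right fun hH => ?_
      obtain ⟨e, he⟩ := exists_range_eq hH
      rw [hF.basisSets_level hij hX₁ h₁ he, hF.basisSets_level hij hX₂ h₂ he]

/-- The components fixed by `J` are constant on the connected set `X`, so a non-empty section is the
graph of `f` over a section of `X`, which is connected by semi-monotonicity. -/
theorem IsAdmissible.isPreconnected_of_indepOf {n : ℕ} {X : Set (Fin n → ℝ)}
    {f : (Fin n → ℝ) → Fin k → ℝ} (ha : IsAdmissible X f) (J : Finset (Fin n ⊕ Fin k))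
    (q : Fin n ⊕ Fin k → ℝ)
    (hind : ∀ i, Sum.inr i ∈ J → ∀ j, IndepOf X (fun x => f x i) j) :
    IsPreconnected (mapGraph X f ∩ agreeSet J q) := by
  obtain ⟨-, hX, hf, -⟩ := ha
  have hXc : IsPreconnected X := by
    simpa using hX.2.2 univ ⟨∅, fun _ => Ordering.eq, 0, by simp⟩
  have hconst : ∀ i, Sum.inr i ∈ J → ∀ x ∈ X, ∀ y ∈ X, f x i = f y i := fun i hi x hx y hy =>
    eq_of_indep_of_isPreconnected hX.1 (fun x => f x i) Finset.univ
      (fun j _ => hind i hi j) subset_rfl (by simp) hXc hx hy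
  rcases eq_empty_or_nonempty (mapGraph X f ∩ agreeSet J q) with h | h
  · rw [h]; exact isPreconnected_empty
  obtain ⟨_, ⟨x₀, hx₀, rfl⟩, hq⟩ := h
  have heq : mapGraph X f ∩ agreeSet J q = (fun x => (Sum.elim x (f x) : Fin n ⊕ Fin k → ℝ)) ''
      (X ∩ ⋂ j ∈ J.toLeft, coordSet j Ordering.eq (q (Sum.inl j))) := by
    ext p
    simp only [mem_inter_iff, mem_image, mem_iInter, mem_coordSet_eq, Finset.mem_toLeft]
    constructor
    · rintro ⟨⟨x, hx, rfl⟩, hp⟩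
      exact ⟨x, ⟨hx, fun j hj => hp _ hj⟩, rfl⟩
    · rintro ⟨x, ⟨hx, hp⟩, rfl⟩
      refine ⟨⟨x, hx, rfl⟩, ?_⟩
      rintro (j | i) hj
      · exact hp j hj
      · exact (hconst i hj x hx x₀ hx₀).trans (hq _ hj)
  rw [heq]
  exact (hX.2.2 _ ⟨_, fun _ => Ordering.eq, fun j => q (Sum.inl j), rfl⟩).image _
    ((continuousOn_elim hf).mono inter_subset_left)

/-- If `J` fixes a `y i` that depends on some `x j`, the section lies in one level set, which is the
graph of a monotone map in one dimension less. For `n = 1` strict monotonicity leaves at most one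
point. -/
theorem IsMonotoneMap.isPreconnected_inter_agreeSet : ∀ (n : ℕ) (X : Set (Fin n → ℝ))
    (f : (Fin n → ℝ) → Fin k → ℝ), IsMonotoneMap n X f →
      ∀ (J : Finset (Fin n ⊕ Fin k)) (q : Fin n ⊕ Fin k → ℝ),
        IsPreconnected (mapGraph X f ∩ agreeSet J q)
  | 0, X, f, hf, J, q => by
    rw [IsMonotoneMap] at hf
    exact hf.elim
  | 1, X, f, hf, J, q => by
    rw [IsMonotoneMap] at hf
    obtain ⟨ha, hm⟩ := hf
    by_cases hind : ∀ i, Sum.inr i ∈ J → ∀ j, IndepOf X (fun x => f x i) j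
    · exact ha.isPreconnected_of_indepOf J q hind
    push Not at hind
    obtain ⟨i, hi, j, hij⟩ := hind
    have hagree : ∀ x y : Fin 1 → ℝ, AgreeOff j x y := fun x y l hl =>
      absurd (Subsingleton.elim l j) hl
    have hext : ∀ x y : Fin 1 → ℝ, x j = y j → x = y := fun x y h => by
      ext l; rwa [Subsingleton.elim l j]
    have hinj : ∀ x ∈ X, ∀ y ∈ X, f x i = f y i → x = y := by
      intro x hx y hy hxy
      refine hext x y ?_
      by_contra hne
      rcases (hm i).2.2 j with h | h | h
      · rcases lt_or_gt_of_ne hne with hlt | hlt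
        · exact (h x hx y hy (hagree x y) hlt).ne hxy
        · exact (h y hy x hx (hagree y x) hlt).ne hxy.symm
      · rcases lt_or_gt_of_ne hne with hlt | hlt
        · exact (h x hx y hy (hagree x y) hlt).ne hxy.symm
        · exact (h y hy x hx (hagree y x) hlt).ne hxy
      · exact hij h
    refine Set.Subsingleton.isPreconnected ?_
    rintro _ ⟨⟨x, hx, rfl⟩, hxq⟩ _ ⟨⟨y, hy, rfl⟩, hyq⟩
    rw [hinj x hx y hy ((hxq _ hi).trans (hyq _ hi).symm)]
  | n + 2, X, f, hf, J, q => by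
    classical
    rw [IsMonotoneMap] at hf
    obtain ⟨ha, hm⟩ := hf
    by_cases hind : ∀ i, Sum.inr i ∈ J → ∀ j, IndepOf X (fun x => f x i) j
    · exact ha.isPreconnected_of_indepOf J q hind
    push Not at hind
    obtain ⟨i, hi, j, hij⟩ := hind
    rcases eq_empty_or_nonempty (mapGraph X f ∩ agreeSet J q) with h | h
    · rw [h]; exact isPreconnected_empty
    obtain ⟨_, ⟨x₀, hx₀, rfl⟩, hq⟩ := h
    obtain ⟨X', g, hlev, hg⟩ := (hm i j hij).1 (q (Sum.inr i)) ⟨x₀, hx₀, hq _ hi⟩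
    rw [isLevelMap_iff] at hlev
    set b := q (Sum.inr i) with hb
    have heq : mapGraph X f ∩ agreeSet J q = levelLift i j b '' (mapGraph X' g ∩
        agreeSet (Finset.univ.filter fun l => levelEmb i j l ∈ J) (q ∘ levelEmb i j)) := by
      rw [hlev]
      ext p
      constructor
      · rintro ⟨hp, hpq⟩
        exact ⟨_, ⟨⟨p, ⟨hp, hpq _ hi⟩, rfl⟩, fun l hl => hpq _ (Finset.mem_filter.1 hl).2⟩,
          levelLift_of_comp i j b p (hpq _ hi)⟩
      · rintro ⟨_, ⟨⟨p, ⟨hp, hpb⟩, rfl⟩, hpq⟩, rfl⟩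
        simp only
        rw [levelLift_of_comp i j b p hpb]
        refine ⟨hp, fun l hl => ?_⟩
        have hlev' : ∀ l', levelEmb i j l' ∈ J → p (levelEmb i j l') = q (levelEmb i j l') :=
          fun l' hl' => hpq l' (by simpa using hl')
        by_cases hli : l = Sum.inr i
        · rw [hli]; exact hpb
        -- Only `y i` is lost in passing to the level map, and its value is already fixed by the
        -- level.
        · have : l ∈ range (levelEmb i j) := by
            rcases l with l | l
            · refine Fin.succAboveCases j ?_ (fun a => ?_) l
              · exact ⟨Sum.inr i, levelEmb_inr_self i j⟩
              · exact ⟨Sum.inl a, levelEmb_inl i j a⟩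
            · exact ⟨Sum.inr l, levelEmb_inr j fun h => hli (by rw [h])⟩
          obtain ⟨l', rfl⟩ := this
          exact hlev' l' hl
    rw [heq]
    exact (IsMonotoneMap.isPreconnected_inter_agreeSet (n + 1) X' g hg _ _).image _
      (continuous_levelLift i j b).continuousOn

end MonotoneMaps

theorem theorem4p3 (L : FirstOrder.Language.{u, v}) [L.Structure ℝ]
    (hL : MonotoneMaps.IsOMinimal L)
    (n k : ℕ) (hn : 1 ≤ n) (hk : 1 ≤ k)
    (X : Set (Fin n → ℝ)) (hXo : IsOpen X) (hXb : Bornology.IsBounded X) (hXne : X.Nonempty)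
    (f : (Fin n → ℝ) → Fin k → ℝ)
    (hdef : (Set.univ : Set ℝ).Definable L (MonotoneMaps.mapGraph X f))
    (hcont : ContinuousOn f X) (hbdd : Bornology.IsBounded (f '' X))
    (hqa : MonotoneMaps.IsQuasiAffine X f) :
    List.TFAE [
      MonotoneMaps.IsMonotoneMap n X f,
      ∀ S : Set (Fin n ⊕ Fin k → ℝ), MonotoneMaps.IsAffineCoordSubspace S →
        IsPreconnected (MonotoneMaps.mapGraph X f ∩ S),
      ∀ C : Set (Fin n ⊕ Fin k → ℝ), MonotoneMaps.IsCoordCone C →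
        IsPreconnected (MonotoneMaps.mapGraph X f ∩ C)] := by
  open MonotoneMaps in
  have h23 : (∀ S : Set (Fin n ⊕ Fin k → ℝ), IsAffineCoordSubspace S →
      IsPreconnected (mapGraph X f ∩ S)) → IsRegular n (mapGraph X f) :=
    isRegular_mapGraph hXo hXne hcont hqa
  tfae_have 1 → 2 := by
    intro h S hS
    obtain ⟨J, q, rfl⟩ := hS.exists_eq_agreeSet
    exact MonotoneMaps.IsMonotoneMap.isPreconnected_inter_agreeSet n X f h J q
  tfae_have 2 → 3 := fun h C hC => (h23 h).isPreconnected_inter_cone hC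
  tfae_have 3 → 2 := by
    rintro h S ⟨J, c, rfl⟩
    exact h _ ⟨J, fun _ => Ordering.eq, c, rfl⟩
  tfae_have 2 → 1 := by
    intro h
    obtain ⟨n, rfl⟩ := Nat.exists_eq_add_of_le' hn
    exact MonotoneMaps.IsRegular.isMonotoneMap n X f
      (MonotoneMaps.isBounded_mapGraph hXb hbdd) (h23 h) (MonotoneMaps.isChart_inl hXo hcont)
  tfae_finish
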